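/- Let $0<D<\tfrac12$, $\lambda>0$, $\sigma>0$, $T>0$. Let $W=(W_t)_{t\ge 0}$ be a standard Brownian motion and, independent of $W$, let $(\tau_n)_{n\in\mathbb Z}$ be the points of a Poisson point process of rate $\lambda$ on $\mathbb R$, listed in increasing order with $\tau_0<0<\tau_1$. For $t\ge 0$ put $i(t)=\sup\{n\ge 0:\tau_n\le t\}$, $$I_t=\sigma^2\Big[(t-\tau_{i(t)})^{2D}+\sum_{k=1}^{i(t)}(\tau_k-\tau_{k-1})^{2D}-(-\tau_0)^{2D}\Big],\qquad X_t=W_{I_t},$$ and for $N\ge 1$, $0<t\le T$, $$Q_T^{(N)}(t)=\frac1t\sum_{n=0}^{N}\Big[\big(X_{(n+1)T/N}-X_{nT/N}\big)^2-\big(X_{(n+1)(T-t)/N}-X_{n(T-t)/N}\big)^2\Big].$$ Let $m=T-\tau_{i(T)}$, $\alpha=\tau_{i(T)}-\tau_{i(T)-1}$, $K=\big(\tfrac1{2D}\big)^{1/(1-2D)}$, and let $E$ be the event that $i(T)\ge 1$ and $m<K\alpha$. Then there are random variables $a,b$, which are measurable functions of the shock times $(\tau_n)_{n\in\mathbb Z}$,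 such that almost surely on $E$ $$0<a<m<b\le T,$$ and, with $\mathcal I=[a,b]$: 1. there are random variables $\mu_N$, $N\ge1$, such that almost surely on $E$ each $\mu_N$ is an absolute maximum point of $Q_T^{(N)}$ on $\mathcal I$; 2. for every sequence $(\mu_N)_{N\ge1}$ of real-valued functions on the sample space such that almost surely on $E$ each $\mu_N$ is an absolute maximum point of $Q_T^{(N)}$ on $\mathcal I$, one has $\mu_N\to m$ in probability on $E$ as $N\to\infty$, that is, $\mathbb P\big(E\cap\{|\mu_N-m|\ge\varepsilon\}\big)\to 0$ for every $\varepsilon>0$ (outer probability if $\mu_N$ is not measurable). -/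

import Mathlib

open MeasureTheory ProbabilityTheory Filter
open scoped NNReal ENNReal

namespace ShockModel

noncomputable section

/-- Number of points of the configuration `(τ n ω)`, `n ∈ ℤ`, lying in `B`. -/
def pointCount {Ω : Type*} (τ : ℤ → Ω → ℝ) (B : Set ℝ) (ω : Ω) : ℕ :=
  Set.ncard {n : ℤ | τ n ω ∈ B}

/-- `τ` is a (homogeneous) Poisson point process of rate `lam` on `ℝ`: its points are enumerated
increasingly by `ℤ`, without accumulation, with the convention `τ 0 < 0 < τ 1`; the number of
points in a bounded Borel set `B` is Poisson with mean `lam * |B|`; and the numbers of points in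
disjoint bounded Borel sets are independent. -/
structure IsPoissonPointProcess {Ω : Type*} [MeasurableSpace Ω] (lam : ℝ) (τ : ℤ → Ω → ℝ)
    (P : Measure Ω) : Prop where
  measurable : ∀ n, Measurable (τ n)
  strictMono : ∀ᵐ ω ∂P, StrictMono (fun n => τ n ω)
  tendsto_atTop : ∀ᵐ ω ∂P, Tendsto (fun n => τ n ω) atTop atTop
  tendsto_atBot : ∀ᵐ ω ∂P, Tendsto (fun n => τ n ω) atBot atBot
  labelling : ∀ᵐ ω ∂P, τ 0 ω < 0 ∧ 0 < τ 1 ω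
  hasLaw_count : ∀ B : Set ℝ, MeasurableSet B → Bornology.IsBounded B →
    HasLaw (pointCount τ B) (poissonMeasure (Real.toNNReal (lam * volume.real B))) P
  indep_count : ∀ (k : ℕ) (B : Fin k → Set ℝ), (∀ j, MeasurableSet (B j)) →
    (∀ j, Bornology.IsBounded (B j)) → Pairwise (fun j l => Disjoint (B j) (B l)) →
    iIndepFun (fun j => pointCount τ (B j)) P

/-- `i(t) = sup {n ≥ 0 : τ n ≤ t}`, the number of shocks in `(0, t]`. -/
def shockIndex {Ω : Type*} (τ : ℤ → Ω → ℝ) (t : ℝ) (ω : Ω) : ℕ :=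
  sSup {n : ℕ | τ (n : ℤ) ω ≤ t}

/-- The time change
`I_t = σ² [(t - τ_{i(t)})^{2D} + ∑_{k=1}^{i(t)} (τ_k - τ_{k-1})^{2D} - (-τ_0)^{2D}]`, `t ≥ 0`. -/
def timeChange {Ω : Type*} (D σ : ℝ) (τ : ℤ → Ω → ℝ) (t : ℝ) (ω : Ω) : ℝ :=
  σ ^ 2 * ((t - τ (shockIndex τ t ω : ℤ) ω) ^ (2 * D)
    + ∑ k ∈ Finset.Icc 1 (shockIndex τ t ω), (τ (k : ℤ) ω - τ ((k : ℤ) - 1) ω) ^ (2 * D)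
    - (-τ 0 ω) ^ (2 * D))

/-- The detrended log-price `X_t = W_{I_t}`, `t ≥ 0`. -/
def logPrice {Ω : Type*} (D σ : ℝ) (W : ℝ≥0 → Ω → ℝ) (τ : ℤ → Ω → ℝ) (t : ℝ) (ω : Ω) : ℝ :=
  W (Real.toNNReal (timeChange D σ τ t ω)) ω

/-- The discretized squared-increment quotient
`Q_T^{(N)}(t) = (1/t) ∑_{n=0}^{N} [ (X_{(n+1)T/N} - X_{nT/N})²
  - (X_{(n+1)(T-t)/N} - X_{n(T-t)/N})² ]`, for `N ≥ 1` and `0 < t ≤ T`. -/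
def discreteQuotient {Ω : Type*} (D σ : ℝ) (W : ℝ≥0 → Ω → ℝ) (τ : ℤ → Ω → ℝ) (T : ℝ) (N : ℕ)
    (t : ℝ) (ω : Ω) : ℝ :=
  1 / t * ∑ n ∈ Finset.range (N + 1),
    ((logPrice D σ W τ (((n : ℝ) + 1) * T / N) ω - logPrice D σ W τ ((n : ℝ) * T / N) ω) ^ 2
      - (logPrice D σ W τ (((n : ℝ) + 1) * (T - t) / N) ω
          - logPrice D σ W τ ((n : ℝ) * (T - t) / N) ω) ^ 2)

/-- `m = T - τ_{i(T)}`, the time elapsed at `T` since the last shock. -/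
def timeSinceShock {Ω : Type*} (τ : ℤ → Ω → ℝ) (T : ℝ) (ω : Ω) : ℝ :=
  T - τ (shockIndex τ T ω : ℤ) ω

/-- `α = τ_{i(T)} - τ_{i(T)-1}`, the gap between the last two shocks before `T`. -/
def lastGap {Ω : Type*} (τ : ℤ → Ω → ℝ) (T : ℝ) (ω : Ω) : ℝ :=
  τ (shockIndex τ T ω : ℤ) ω - τ ((shockIndex τ T ω : ℤ) - 1) ω

/-- `K = (1/(2D))^{1/(1-2D)}`, for `0 < D < 1/2`. -/
def gapConst (D : ℝ) : ℝ := (1 / (2 * D)) ^ (1 / (1 - 2 * D))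

/-- The event that there is a shock in `(0, T]` and `m < K α`. -/
def recentShock {Ω : Type*} (D : ℝ) (τ : ℤ → Ω → ℝ) (T : ℝ) : Set Ω :=
  {ω | 1 ≤ shockIndex τ T ω ∧ timeSinceShock τ T ω < gapConst D * lastGap τ T ω}

/-- On the event `E`, almost surely, `μ N` is an absolute maximum point of the random function
`Q N` on the random interval `[a, b]`, for every `N ≥ 1`. -/
def AreMaxPoints {Ω : Type*} [MeasurableSpace Ω] (P : Measure Ω) (E : Set Ω)
    (Q : ℕ → ℝ → Ω → ℝ) (a b : Ω → ℝ) (μ : ℕ → Ω → ℝ) : Prop :=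
  ∀ N : ℕ, 1 ≤ N → ∀ᵐ ω ∂P, ω ∈ E →
    μ N ω ∈ Set.Icc (a ω) (b ω) ∧ IsMaxOn (fun t => Q N t ω) (Set.Icc (a ω) (b ω)) (μ N ω)

end

end ShockModel

namespace ShockModel

/-! ### Exponential moments of squared Gaussians and a Chernoff bound for squared Brownian
increments. -/

section

/-! Fix the shocks, so that the clock `J = I` is deterministic, and let `RV_N(S)` be the sum of
squared increments of `W ∘ J` on the grid of mesh `S / N`. Then `Q_N(t) = (RV_N(T) - RV_N(T - t)) /
t`. A squared increment of `W ∘ J` has mean the increment of `J`, so `Q_N` should approach `q(t) =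
(J(T) - J(T - t)) / t`.

The limit `q` has a strict maximum at `m` on a suitable interval (`quotient_lt`). Its value there is
`σ² m^(2D-1)`. For `t < m` it is smaller by concavity of `x ^ (2D)`. Beyond `m`, `J(T) - J(T - t)`
grows with slope `2D σ² c^(2D-1)`, where `c` is the age of the preceding gap at time `T - t`; this
is below `σ² m^(2D-1)` exactly when `c > m / K`. Since `c` starts at `α`, the condition `m < K α`
leaves room to the right of `m`.

The convergence must be uniform in the horizon `S` (`ae_tendsto_realizedVar`). For one horizon, a
Chernoff bound and the Hölder continuity of `J` give deviation probabilities of order `exp(-c N^p)`.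
This survives a union over polynomially many horizons, and Borel–Cantelli applies. Between net
points, the Hölder continuity of `W` and `J` makes the error negligible once the net is fine enough.
Uniform convergence and the gap between `q(m)` and `q` away from `m` then force maximum points
towards `m`.

Random shocks are handled by independence and Fubini on the space of pairs (shocks, path). This
requires measurable events: maximum points far from `m` are caught in `farNearMax`, a countable
condition, and path evaluation is replaced by the jointly measurable `evalLimsup`. -/

lemma integrable_exp_mul_sq_gaussianReal (v : ℝ≥0) {θ : ℝ} (h : 2 * θ * v < 1) :
    Integrable (fun x : ℝ => Real.exp (θ * x ^ 2)) (gaussianReal 0 v) := by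
  rcases eq_or_ne v 0 with rfl | hv
  · rw [gaussianReal_zero_var]
    exact integrable_dirac (by simp)
  have hv' : (0 : ℝ) < v := by positivity
  rw [gaussianReal_of_var_ne_zero _ hv, integrable_withDensity_iff_integrable_smul'
    (measurable_gaussianPDF 0 v) (ae_of_all _ fun x => gaussianPDF_lt_top)]
  have hb : 0 < 1 / (2 * (v : ℝ)) - θ := by
    rw [sub_pos, lt_div_iff₀ (by positivity)]
    linarith
  refine ((integrable_exp_neg_mul_sq hb).const_mul (√(2 * Real.pi * v))⁻¹).congr
    (ae_of_all _ fun x => ?_)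
  simp only [toReal_gaussianPDF, gaussianPDFReal, smul_eq_mul, mul_assoc, ← Real.exp_add]
  congr 2
  field_simp
  ring

lemma integral_exp_mul_sq_gaussianReal (v : ℝ≥0) {θ : ℝ} (h : 2 * θ * v < 1) :
    ∫ x, Real.exp (θ * x ^ 2) ∂(gaussianReal 0 v) = (√(1 - 2 * θ * v))⁻¹ := by
  rcases eq_or_ne v 0 with rfl | hv
  · simp
  have hv' : (0 : ℝ) < v := by positivity
  have hb : 0 < 1 / (2 * (v : ℝ)) - θ := by
    rw [sub_pos, lt_div_iff₀ (by positivity)]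
    linarith
  rw [integral_gaussianReal_eq_integral_smul hv]
  have : ∀ x : ℝ, gaussianPDFReal 0 v x • Real.exp (θ * x ^ 2)
      = (√(2 * Real.pi * v))⁻¹ * Real.exp (-(1 / (2 * (v : ℝ)) - θ) * x ^ 2) := by
    intro x
    simp only [gaussianPDFReal, smul_eq_mul, mul_assoc, ← Real.exp_add]
    congr 2
    field_simp
    ring
  simp_rw [this]
  rw [integral_const_mul, integral_gaussian, ← Real.sqrt_inv, ← Real.sqrt_mul (by positivity),
    ← Real.sqrt_inv]
  congr 1
  have h2 : 1 - 2 * θ * v ≠ 0 := by linarith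
  have h3 : 1 / (2 * (v : ℝ)) - θ = (1 - 2 * θ * v) / (2 * v) := by
    field_simp
  rw [h3]
  field_simp

/-- Taylor expansion of `log (1 - u)` to first order, with the remainder bounded by `2 u ^ 2`. -/
lemma inv_sqrt_one_sub_le_exp {u : ℝ} (hu : |u| ≤ 1 / 2) :
    (√(1 - u))⁻¹ ≤ Real.exp (u / 2 + u ^ 2) := by
  have h1 := Real.abs_log_sub_add_sum_range_le (x := u) (by linarith) 1
  have hu' := abs_le.1 hu
  have hpos : 0 < 1 - u := by linarith
  simp only [Finset.range_one, Finset.sum_singleton, zero_add, pow_one, Nat.cast_zero,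
    div_one] at h1
  have h2 : |u| ^ (1 + 1) / (1 - |u|) ≤ 2 * u ^ 2 := by
    rw [div_le_iff₀ (by linarith), show 1 + 1 = 2 from rfl, sq_abs]
    nlinarith [sq_nonneg u]
  have h3 : -Real.log (1 - u) ≤ u + 2 * u ^ 2 := by
    have := (abs_le.1 (h1.trans h2)).1
    linarith
  rw [Real.sqrt_eq_rpow, ← Real.rpow_neg hpos.le, Real.rpow_def_of_pos hpos]
  apply Real.exp_le_exp.2
  linarith

/-- With `u = 2 θ v`, centring cancels the linear term `u / 2`, so only the quadratic term `u ^ 2`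
survives: the centred square is sub-exponential. -/
lemma integral_exp_mul_sq_sub_gaussianReal_le (v : ℝ≥0) {θ : ℝ} (h : |θ| * v ≤ 1 / 4) :
    ∫ x, Real.exp (θ * (x ^ 2 - v)) ∂(gaussianReal 0 v) ≤ Real.exp (4 * θ ^ 2 * v ^ 2) := by
  have habs : |2 * θ * v| ≤ 1 / 2 := by
    rw [abs_mul, abs_mul, abs_of_nonneg (NNReal.coe_nonneg v)]
    norm_num
    linarith
  have h1 : 2 * θ * v < 1 := by linarith [(abs_le.1 habs).2]
  have : ∀ x : ℝ, Real.exp (θ * (x ^ 2 - v)) = Real.exp (-θ * v) * Real.exp (θ * x ^ 2) := by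
    intro x
    rw [← Real.exp_add]
    ring_nf
  simp_rw [this]
  rw [integral_const_mul, integral_exp_mul_sq_gaussianReal v h1]
  calc Real.exp (-θ * v) * (√(1 - 2 * θ * v))⁻¹
      ≤ Real.exp (-θ * v) * Real.exp (2 * θ * v / 2 + (2 * θ * v) ^ 2) := by
        gcongr
        exact inv_sqrt_one_sub_le_exp habs
    _ = _ := by
        rw [← Real.exp_add]
        ring_nf

variable {Ω : Type*} [MeasurableSpace Ω] {P : Measure Ω} {W : ℝ≥0 → Ω → ℝ}

lemma hasLaw_increment (hW : IsPreBrownianReal W P) {s t : ℝ≥0} (hst : s ≤ t) :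
    HasLaw (fun ω => W t ω - W s ω) (gaussianReal 0 (t - s)) P := by
  have h := hW.hasLaw_sub t s
  have h2 : nndist (t : ℝ) (s : ℝ) = t - s := by
    ext
    rw [coe_nndist, Real.dist_eq, NNReal.coe_sub hst, abs_of_nonneg]
    exact sub_nonneg.2 (by exact_mod_cast hst)
  rw [← h2]
  exact h

lemma integrable_exp_increment (hW : IsPreBrownianReal W P) {s t : ℝ≥0} (hst : s ≤ t) {θ : ℝ}
    (h : |θ| * (t - s : ℝ≥0) ≤ 1 / 4) (c : ℝ) :
    Integrable (fun ω => Real.exp (θ * ((W t ω - W s ω) ^ 2 - c))) P := by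
  have h1 : 2 * θ * (t - s : ℝ≥0) < 1 := by
    nlinarith [le_abs_self θ, NNReal.coe_nonneg (t - s)]
  have hl := hasLaw_increment hW hst
  have hi := integrable_exp_mul_sq_gaussianReal _ h1
  rw [← hl.map_eq] at hi
  have hi2 := hi.comp_aemeasurable hl.aemeasurable
  refine (hi2.const_mul (Real.exp (-θ * c))).congr (ae_of_all _ fun ω => ?_)
  simp only [Function.comp, ← Real.exp_add]
  ring_nf

lemma mgf_sq_increment_le (hW : IsPreBrownianReal W P) {s t : ℝ≥0} (hst : s ≤ t) {θ : ℝ}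
    (h : |θ| * (t - s : ℝ≥0) ≤ 1 / 4) :
    mgf (fun ω => (W t ω - W s ω) ^ 2 - (t - s : ℝ≥0)) P θ
      ≤ Real.exp (4 * θ ^ 2 * (t - s : ℝ≥0) ^ 2) := by
  have hl := hasLaw_increment hW hst
  refine le_trans (le_of_eq ?_) (integral_exp_mul_sq_sub_gaussianReal_le (t - s) h)
  exact hl.integral_comp (f := fun x => Real.exp (θ * (x ^ 2 - (t - s : ℝ≥0))))
    (by fun_prop)

lemma indep_sq_increments (hW : IsPreBrownianReal W P) {u : ℕ → ℝ≥0} (hu : Monotone u) (n : ℕ) :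
    iIndepFun (fun (i : Fin n) ω =>
      (W (u (i + 1)) ω - W (u i) ω) ^ 2 - ((u (i + 1) - u i : ℝ≥0) : ℝ)) P := by
  have h := hW.hasIndepIncrements n (fun i => u i) (fun i j hij => hu (by exact_mod_cast hij))
  exact h.comp (fun i x => x ^ 2 - ((u (i + 1) - u i : ℝ≥0) : ℝ)) (fun i => by fun_prop)

/-- Chernoff at `θ = ± η / M`. The log-moment is at most `4 θ² ∑ Δ² ≤ 4 θ² M L`, which `hηL` makes
at most half of `θ ε` in absolute value. The exponent scales like the inverse of the largest step
`M`, which yields the stretched exponential decay later. -/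
lemma measure_sum_sq_increments_le [IsProbabilityMeasure P] (hWm : ∀ t, Measurable (W t))
    (hW : IsPreBrownianReal W P) {u : ℕ → ℝ≥0} (hu : Monotone u) (n : ℕ) {M L η ε : ℝ}
    (hM : 0 < M) (hL : (u n : ℝ) ≤ L) (hinc : ∀ i < n, (u (i + 1) : ℝ) - u i ≤ M)
    (hη : 0 ≤ η) (hη4 : η ≤ 1 / 4) (hηL : 8 * η * L ≤ ε) :
    P.real {ω | ε ≤ |∑ i ∈ Finset.range n,
      ((W (u (i + 1)) ω - W (u i) ω) ^ 2 - ((u (i + 1) : ℝ) - u i))|}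
      ≤ 2 * Real.exp (-(η * ε / (2 * M))) := by
  set X : Fin n → Ω → ℝ := fun i ω =>
    (W (u (i + 1)) ω - W (u i) ω) ^ 2 - ((u (i + 1) - u i : ℝ≥0) : ℝ) with hX
  have hle : ∀ i : ℕ, u i ≤ u (i + 1) := fun i => hu (Nat.le_succ i)
  have hcoe : ∀ i : ℕ, ((u (i + 1) - u i : ℝ≥0) : ℝ) = (u (i + 1) : ℝ) - u i :=
    fun i => NNReal.coe_sub (hle i)
  have hXm : ∀ i, Measurable (X i) := fun i =>
    (((hWm _).sub (hWm _)).pow_const 2).sub_const _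
  have hsum : ∀ ω, ∑ i ∈ Finset.range n,
      ((W (u (i + 1)) ω - W (u i) ω) ^ 2 - ((u (i + 1) : ℝ) - u i)) = (∑ i, X i) ω := by
    intro ω
    rw [Finset.sum_apply, Finset.sum_range]
    exact Finset.sum_congr rfl fun i _ => by rw [hX]; simp only [hcoe]
  have hind : iIndepFun X P := indep_sq_increments hW hu n
  have hθ : ∀ θ : ℝ, |θ| ≤ η / M → ∀ i : Fin n,
      |θ| * ((u (i + 1) - u i : ℝ≥0) : ℝ) ≤ 1 / 4 := by
    intro θ h i
    calc |θ| * ((u (i + 1) - u i : ℝ≥0) : ℝ) ≤ η / M * M := by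
          gcongr
          rw [hcoe]
          exact hinc i i.2
      _ = η := by field_simp
      _ ≤ 1 / 4 := hη4
  have hint : ∀ θ : ℝ, |θ| ≤ η / M →
      Integrable (fun ω => Real.exp (θ * (∑ i, X i) ω)) P := fun θ h =>
    hind.integrable_exp_mul_sum hXm fun i _ => integrable_exp_increment hW (hle i) (hθ θ h i) _
  have hmgf : ∀ θ : ℝ, |θ| = η / M → mgf (∑ i, X i) P θ ≤ Real.exp (η * ε / (2 * M)) := by
    intro θ h
    rw [hind.mgf_sum hXm]
    calc ∏ i, mgf (X i) P θ
        ≤ ∏ i : Fin n, Real.exp (4 * θ ^ 2 * ((u (i + 1) - u i : ℝ≥0) : ℝ) ^ 2) :=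
          Finset.prod_le_prod (fun i _ => mgf_nonneg)
            fun i _ => mgf_sq_increment_le hW (hle i) (hθ θ h.le i)
      _ = Real.exp (∑ i : Fin n, 4 * θ ^ 2 * ((u (i + 1) - u i : ℝ≥0) : ℝ) ^ 2) :=
          (Real.exp_sum _ _).symm
      _ ≤ Real.exp (η * ε / (2 * M)) := by
          apply Real.exp_le_exp.2
          calc ∑ i : Fin n, 4 * θ ^ 2 * ((u (i + 1) - u i : ℝ≥0) : ℝ) ^ 2
              ≤ ∑ i : Fin n, 4 * θ ^ 2 * M * ((u (i + 1) : ℝ) - u i) := by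
                refine Finset.sum_le_sum fun i _ => ?_
                have h0 : (0 : ℝ) ≤ (u (i + 1) : ℝ) - u i := by
                  rw [← hcoe]; exact NNReal.coe_nonneg _
                have h1 := hinc i i.2
                rw [hcoe, mul_assoc _ M]
                gcongr
                nlinarith
            _ = 4 * θ ^ 2 * M * ((u n : ℝ) - u 0) := by
                rw [← Finset.mul_sum, ← Finset.sum_range fun i => (u (i + 1) : ℝ) - u i,
                  Finset.sum_range_sub fun i => (u i : ℝ)]
            _ ≤ 4 * θ ^ 2 * M * L := by
                gcongr
                linarith [NNReal.coe_nonneg (u 0)]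
            _ = 4 * η ^ 2 * L / M := by
                rw [← sq_abs θ, h]
                field_simp
            _ ≤ η * ε / (2 * M) := by
                rw [div_le_div_iff₀ hM (by positivity)]
                nlinarith [mul_le_mul_of_nonneg_left hηL (mul_nonneg hη hM.le)]
  have hηM : 0 ≤ η / M := by positivity
  have hup : P.real {ω | ε ≤ (∑ i, X i) ω} ≤ Real.exp (-(η * ε / (2 * M))) := by
    have ha : |η / M| = η / M := abs_of_nonneg hηM
    refine (measure_ge_le_exp_mul_mgf ε hηM (hint _ ha.le)).trans ?_
    calc Real.exp (-(η / M) * ε) * mgf (∑ i, X i) P (η / M)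
        ≤ Real.exp (-(η / M) * ε) * Real.exp (η * ε / (2 * M)) := by
          gcongr
          exact hmgf _ ha
      _ = _ := by
          rw [← Real.exp_add]
          congr 1
          field_simp
          ring
  have hlow : P.real {ω | (∑ i, X i) ω ≤ -ε} ≤ Real.exp (-(η * ε / (2 * M))) := by
    have ha : |-(η / M)| = η / M := by rw [abs_neg, abs_of_nonneg hηM]
    refine (measure_le_le_exp_mul_mgf (-ε) (by linarith) (hint _ ha.le)).trans ?_
    calc Real.exp (-(-(η / M)) * -ε) * mgf (∑ i, X i) P (-(η / M))
        ≤ Real.exp (-(-(η / M)) * -ε) * Real.exp (η * ε / (2 * M)) := by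
          gcongr
          exact hmgf _ ha
      _ = _ := by
          rw [← Real.exp_add]
          congr 1
          field_simp
          ring
  calc _ ≤ P.real ({ω | ε ≤ (∑ i, X i) ω} ∪ {ω | (∑ i, X i) ω ≤ -ε}) := by
        refine measureReal_mono (fun ω hω => ?_) (measure_ne_top _ _)
        simp only [Set.mem_ofPred_eq, hsum] at hω
        rcases le_abs.1 hω with h | h
        · exact Or.inl h
        · exact Or.inr (by simp only [Set.mem_ofPred_eq]; linarith)
    _ ≤ _ := (measureReal_union_le _ _).trans (by linarith)

end

/-! ### Hölder continuity of Brownian paths by dyadic chaining. -/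

section

variable {Ω : Type*} [MeasurableSpace Ω] {P : Measure Ω} {W : ℝ≥0 → Ω → ℝ}

/-- The exponential bound at `θ = 1 / (4 v)`, weakened by `exp y ≥ y ^ 2 / 2` to the strength of a
fourth-moment estimate, which is enough for some Hölder exponent. -/
lemma measure_sq_increment_ge_le [IsProbabilityMeasure P] (hW : IsPreBrownianReal W P)
    {s t : ℝ≥0} (hst : s < t) {x : ℝ} (hx : 0 < x) :
    P.real {ω | x ≤ (W t ω - W s ω) ^ 2} ≤ 64 * (t - s : ℝ≥0) ^ 2 / x ^ 2 := by
  have hv : (0 : ℝ) < (t - s : ℝ≥0) := by exact_mod_cast tsub_pos_of_lt hst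
  set v : ℝ := ((t - s : ℝ≥0) : ℝ) with hvdef
  have hθ : |1 / (4 * v)| * v ≤ 1 / 4 := by
    rw [abs_of_pos (by positivity)]
    apply le_of_eq
    field_simp
  have h1 := measure_ge_le_exp_mul_mgf (μ := P) (X := fun ω => (W t ω - W s ω) ^ 2 - v) (x - v)
    (show 0 ≤ 1 / (4 * v) by positivity) (integrable_exp_increment hW hst.le hθ v)
  have h2 := mgf_sq_increment_le hW hst.le hθ
  have h3 : {ω | x - v ≤ (W t ω - W s ω) ^ 2 - v} = {ω | x ≤ (W t ω - W s ω) ^ 2} := by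
    ext ω
    simp
  rw [h3] at h1
  have h4 : (x / (4 * v)) ^ 2 / 2 ≤ Real.exp (x / (4 * v)) := by
    have := Real.quadratic_le_exp_of_nonneg (show 0 ≤ x / (4 * v) by positivity)
    have : 0 ≤ x / (4 * v) := by positivity
    linarith
  have h5 : Real.exp (1 / 2) ≤ 2 := by
    have := Real.exp_one_lt_d9
    have h : Real.exp (1 / 2) ^ 2 = Real.exp 1 := by
      rw [← Real.exp_nat_mul]
      norm_num
    nlinarith [Real.exp_pos (1 / 2)]
  calc P.real {ω | x ≤ (W t ω - W s ω) ^ 2}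
      ≤ Real.exp (-(1 / (4 * v)) * (x - v)) * Real.exp (4 * (1 / (4 * v)) ^ 2 * v ^ 2) :=
        h1.trans (by gcongr)
    _ = Real.exp (1 / 2) * (Real.exp (x / (4 * v)))⁻¹ := by
        rw [← Real.exp_add, ← Real.exp_neg, ← Real.exp_add]
        congr 1
        field_simp
        ring
    _ ≤ 2 * ((x / (4 * v)) ^ 2 / 2)⁻¹ := by gcongr
    _ = 64 * v ^ 2 / x ^ 2 := by
        field_simp
        norm_num

/-- Level `j` has `L 2^j` cells, each bad with probability at most `64 · 4^(-j) / r^(4j)`. The union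
bound is geometric of ratio `1 / (2 r^4) < 1`, and Borel–Cantelli concludes. -/
lemma ae_eventually_dyadic_increments_le [IsProbabilityMeasure P] (hW : IsPreBrownianReal W P)
    {r : ℝ} (hr : 0 < r) (hr4 : 1 < 2 * r ^ 4) (L : ℕ) :
    ∀ᵐ ω ∂P, ∃ k : ℕ, ∀ j ≥ k, ∀ i < L * 2 ^ j,
      |W (((i + 1 : ℕ) : ℝ≥0) / 2 ^ j) ω - W ((i : ℝ≥0) / 2 ^ j) ω| ≤ r ^ j := by
  set B : ℕ → Set Ω := fun j => ⋃ i ∈ Finset.range (L * 2 ^ j),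
    {ω | (r ^ j) ^ 2 ≤ (W (((i + 1 : ℕ) : ℝ≥0) / 2 ^ j) ω - W ((i : ℝ≥0) / 2 ^ j) ω) ^ 2} with hB
  have hcell : ∀ j i : ℕ, P.real
      {ω | (r ^ j) ^ 2 ≤ (W (((i + 1 : ℕ) : ℝ≥0) / 2 ^ j) ω - W ((i : ℝ≥0) / 2 ^ j) ω) ^ 2}
      ≤ 64 * ((1 / 2 : ℝ) ^ j) ^ 2 / ((r ^ j) ^ 2) ^ 2 := by
    intro j i
    have hlt : (i : ℝ≥0) / 2 ^ j < ((i + 1 : ℕ) : ℝ≥0) / 2 ^ j := by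
      gcongr
      exact Nat.lt_succ_self i
    have := measure_sq_increment_ge_le hW hlt (x := (r ^ j) ^ 2) (by positivity)
    have h2 : ((((i + 1 : ℕ) : ℝ≥0) / 2 ^ j - (i : ℝ≥0) / 2 ^ j : ℝ≥0) : ℝ) = (1 / 2 : ℝ) ^ j := by
      rw [NNReal.coe_sub hlt.le]
      push_cast
      rw [div_pow]
      ring
    rwa [h2] at this
  have hBle : ∀ j, P.real (B j) ≤ 64 * L * (1 / (2 * r ^ 4)) ^ j := by
    intro j
    calc P.real (B j) ≤ ∑ i ∈ Finset.range (L * 2 ^ j),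
        P.real {ω | (r ^ j) ^ 2 ≤ (W (((i + 1 : ℕ) : ℝ≥0) / 2 ^ j) ω - W ((i : ℝ≥0) / 2 ^ j) ω) ^ 2} :=
          measureReal_biUnion_finset_le _ _
      _ ≤ ∑ i ∈ Finset.range (L * 2 ^ j), 64 * ((1 / 2 : ℝ) ^ j) ^ 2 / ((r ^ j) ^ 2) ^ 2 :=
          Finset.sum_le_sum fun i _ => hcell j i
      _ = 64 * L * (1 / (2 * r ^ 4)) ^ j := by
          rw [Finset.sum_const, Finset.card_range, nsmul_eq_mul]
          push_cast
          have h1 : (1 / (2 * r ^ 4)) ^ j = 1 / (2 ^ j * (r ^ j) ^ 4) := by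
            rw [div_pow, one_pow, mul_pow, ← pow_mul, ← pow_mul, mul_comm 4 j]
          have : r ^ j ≠ 0 := by positivity
          rw [h1, div_pow, one_pow]
          field_simp
  have hsum : Summable fun j => P.real (B j) := by
    refine Summable.of_nonneg_of_le (fun _ => measureReal_nonneg) hBle
      ((summable_geometric_of_lt_one (by positivity) ?_).mul_left _)
    rw [div_lt_one (by positivity)]
    exact hr4
  have hsum' : ∑' j, P (B j) ≠ ∞ := by
    have := hsum.tsum_ofReal_ne_top
    simpa only [ofReal_measureReal (measure_ne_top _ _)] using this
  filter_upwards [ae_eventually_notMem hsum'] with ω hω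
  obtain ⟨k, hk⟩ := eventually_atTop.1 hω
  refine ⟨k, fun j hj i hi => ?_⟩
  have := hk j hj
  simp only [hB, Set.mem_iUnion, Finset.mem_range, not_exists, Set.mem_ofPred_eq, not_le] at this
  exact (abs_lt_of_sq_lt_sq (this i hi) (by positivity)).le

section Chaining

variable {w : ℝ≥0 → ℝ} {r : ℝ} {L k : ℕ}

/-- Successive dyadic floors of `u` coincide or are the ends of one finer cell, so the path
differences are dominated by a geometric series; continuity lets the level tend to infinity. -/
lemma abs_sub_floor_dyadic_le (hw : Continuous w) (hr : 0 < r) (hr1 : r < 1)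
    (hcell : ∀ j ≥ k, ∀ i < L * 2 ^ j,
      |w (((i + 1 : ℕ) : ℝ≥0) / 2 ^ j) - w ((i : ℝ≥0) / 2 ^ j)| ≤ r ^ j)
    {u : ℝ≥0} (hu : u < L) {j : ℕ} (hj : k ≤ j) :
    |w u - w ((⌊u * 2 ^ j⌋₊ : ℝ≥0) / 2 ^ j)| ≤ r ^ j * (1 - r)⁻¹ := by
  have hstep : ∀ n, |w ((⌊u * 2 ^ (j + n + 1)⌋₊ : ℝ≥0) / 2 ^ (j + n + 1))
      - w ((⌊u * 2 ^ (j + n)⌋₊ : ℝ≥0) / 2 ^ (j + n))| ≤ r ^ (j + n + 1) := by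
    intro n
    set l := j + n with hl
    set a := ⌊u * 2 ^ l⌋₊ with ha
    have ha1 : (a : ℝ≥0) ≤ u * 2 ^ l := Nat.floor_le zero_le
    have ha2 : u * 2 ^ l < a + 1 := Nat.lt_floor_add_one _
    have hb1 : 2 * a ≤ ⌊u * 2 ^ (l + 1)⌋₊ := by
      apply Nat.le_floor
      push_cast
      calc (2 : ℝ≥0) * a ≤ 2 * (u * 2 ^ l) := by gcongr
        _ = _ := by ring
    have hb2 : ⌊u * 2 ^ (l + 1)⌋₊ < 2 * a + 2 := by
      rw [Nat.floor_lt zero_le]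
      push_cast
      calc u * 2 ^ (l + 1) = 2 * (u * 2 ^ l) := by ring
        _ < 2 * (a + 1) := by gcongr
        _ = _ := by ring
    have hpt : ((2 * a : ℕ) : ℝ≥0) / 2 ^ (l + 1) = (a : ℝ≥0) / 2 ^ l := by
      push_cast
      rw [pow_succ']
      field_simp
    have haL : 2 * a < L * 2 ^ (l + 1) := by
      have : (a : ℝ≥0) < L * 2 ^ l := ha1.trans_lt (by gcongr)
      have : a < L * 2 ^ l := by exact_mod_cast this
      rw [pow_succ, ← mul_assoc]
      omega
    rcases (show ⌊u * 2 ^ (l + 1)⌋₊ = 2 * a ∨ ⌊u * 2 ^ (l + 1)⌋₊ = 2 * a + 1 by omega) with h | h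
    · rw [h, hpt, sub_self, abs_zero]
      positivity
    · rw [h, ← hpt]
      exact hcell (l + 1) (by omega) _ haL
  have hsum : ∀ n, |w ((⌊u * 2 ^ (j + n)⌋₊ : ℝ≥0) / 2 ^ (j + n))
      - w ((⌊u * 2 ^ j⌋₊ : ℝ≥0) / 2 ^ j)| ≤ ∑ i ∈ Finset.range n, r ^ j * r ^ i := by
    intro n
    induction n with
    | zero => simp
    | succ n ih =>
      rw [Finset.sum_range_succ]
      have h1 := hstep n
      have h2 : r ^ (j + n + 1) ≤ r ^ j * r ^ n := by
        rw [← pow_add]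
        exact pow_le_pow_of_le_one hr.le hr1.le (by omega)
      calc _ ≤ _ := abs_sub_le _ (w ((⌊u * 2 ^ (j + n)⌋₊ : ℝ≥0) / 2 ^ (j + n))) _
        _ ≤ _ := by
          rw [← add_assoc j n 1]
          linarith
  have hlim : Tendsto (fun n => (⌊u * 2 ^ (j + n)⌋₊ : ℝ≥0) / 2 ^ (j + n)) atTop (nhds u) := by
    have h1 := tendsto_nat_floor_mul_div_atTop (R := ℝ) (a := u) u.2
    have h2 : Tendsto (fun n : ℕ => (2 : ℝ) ^ (j + n)) atTop atTop :=
      (tendsto_pow_atTop_atTop_of_one_lt one_lt_two).comp (tendsto_add_atTop_nat j |>.congr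
        fun n => by rw [add_comm])
    rw [← NNReal.tendsto_coe]
    refine (h1.comp h2).congr fun n => ?_
    simp only [Function.comp, NNReal.coe_div, NNReal.coe_natCast, NNReal.coe_pow, NNReal.coe_ofNat]
    congr 2
  have hlim2 := (((hw.tendsto u).comp hlim).sub_const
    (w ((⌊u * 2 ^ j⌋₊ : ℝ≥0) / 2 ^ j))).abs
  refine le_of_tendsto hlim2 (Eventually.of_forall fun n => (hsum n).trans ?_)
  rw [← Finset.mul_sum]
  gcongr
  rw [← tsum_geometric_of_lt_one hr.le hr1]
  exact (summable_geometric_of_lt_one hr.le hr1).sum_le_tsum _ fun i _ => by positivity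

/-- At distance at most `2^(-j)`, the level-`j` floors of the two points are equal or adjacent: one
cell increment plus two chaining tails. -/
lemma abs_sub_le_of_dyadic (hw : Continuous w) (hr : 0 < r) (hr1 : r < 1)
    (hcell : ∀ j ≥ k, ∀ i < L * 2 ^ j,
      |w (((i + 1 : ℕ) : ℝ≥0) / 2 ^ j) - w ((i : ℝ≥0) / 2 ^ j)| ≤ r ^ j)
    {u v : ℝ≥0} (hu : u < L) (hv : v < L) {j : ℕ} (hj : k ≤ j)
    (huv : |(u : ℝ) - v| ≤ (1 / 2) ^ j) :
    |w u - w v| ≤ 3 * (1 - r)⁻¹ * r ^ j := by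
  wlog hle : u ≤ v generalizing u v
  · rw [abs_sub_comm]
    exact this hv hu (by rwa [abs_sub_comm]) (le_of_not_ge hle)
  have h1 := abs_sub_floor_dyadic_le hw hr hr1 hcell hu hj
  have h2 := abs_sub_floor_dyadic_le hw hr hr1 hcell hv hj
  set a := ⌊u * 2 ^ j⌋₊ with ha
  have hb1 : a ≤ ⌊v * 2 ^ j⌋₊ := Nat.floor_mono (by gcongr)
  have hb2 : ⌊v * 2 ^ j⌋₊ < a + 2 := by
    rw [Nat.floor_lt zero_le]
    have ha2 : u * 2 ^ j < a + 1 := Nat.lt_floor_add_one _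
    have h3 : (v : ℝ) ≤ u + (1 / 2) ^ j := by linarith [(abs_le.1 huv).1]
    have h4 : v * 2 ^ j ≤ u * 2 ^ j + 1 := by
      rw [← NNReal.coe_le_coe]
      push_cast
      calc (v : ℝ) * 2 ^ j ≤ (u + (1 / 2) ^ j) * 2 ^ j := by gcongr
        _ = _ := by rw [add_mul, ← mul_pow]; norm_num
    push_cast
    calc v * 2 ^ j ≤ u * 2 ^ j + 1 := h4
      _ < a + 1 + 1 := by gcongr
      _ = _ := by ring
  have ha1 : (a : ℝ≥0) ≤ u * 2 ^ j := Nat.floor_le zero_le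
  have haL : a < L * 2 ^ j := by
    have : (a : ℝ≥0) < L * 2 ^ j := ha1.trans_lt (by gcongr)
    exact_mod_cast this
  have h1r : 1 ≤ (1 - r)⁻¹ := (one_le_inv₀ (by linarith)).2 (by linarith)
  have hmid : |w ((a : ℝ≥0) / 2 ^ j) - w ((⌊v * 2 ^ j⌋₊ : ℝ≥0) / 2 ^ j)| ≤ (1 - r)⁻¹ * r ^ j := by
    rcases (show ⌊v * 2 ^ j⌋₊ = a ∨ ⌊v * 2 ^ j⌋₊ = a + 1 by omega) with h | h
    · rw [h, sub_self, abs_zero]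
      positivity
    · rw [h, abs_sub_comm]
      exact (hcell j hj a haL).trans (le_mul_of_one_le_left (by positivity) h1r)
  calc |w u - w v| ≤ |w u - w ((a : ℝ≥0) / 2 ^ j)|
        + |w ((a : ℝ≥0) / 2 ^ j) - w ((⌊v * 2 ^ j⌋₊ : ℝ≥0) / 2 ^ j)|
        + |w ((⌊v * 2 ^ j⌋₊ : ℝ≥0) / 2 ^ j) - w v| := by
        refine (abs_sub_le _ (w ((⌊v * 2 ^ j⌋₊ : ℝ≥0) / 2 ^ j)) _).trans ?_
        gcongr
        exact abs_sub_le _ _ _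
    _ ≤ _ := by
        rw [abs_sub_comm _ (w v)]
        linarith

end Chaining

/-- Brownian paths are almost surely locally Hölder continuous of order `1/8`. -/
lemma ae_exists_holder [IsProbabilityMeasure P] (hW : IsBrownianReal W P) (L : ℕ) :
    ∀ᵐ ω ∂P, ∃ K δ : ℝ, 0 < K ∧ 0 < δ ∧ ∀ u v : ℝ≥0, u < L → v < L → |(u : ℝ) - v| ≤ δ →
      |W u ω - W v ω| ≤ K * |(u : ℝ) - v| ^ (1 / 8 : ℝ) := by
  -- This makes `r ^ j = (2^(-j)) ^ (1/8)`, while `2 r^4 = √2 > 1` keeps the union bound summable.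
  set r : ℝ := (1 / 2) ^ (1 / 8 : ℝ) with hrdef
  have hr : 0 < r := by positivity
  have hr1 : r < 1 := Real.rpow_lt_one (by norm_num) (by norm_num) (by norm_num)
  have hr8 : (r ^ 4) ^ 2 = 1 / 2 := by
    rw [← pow_mul, hrdef, ← Real.rpow_natCast, ← Real.rpow_mul (by norm_num)]
    norm_num
  have hr4 : 1 < 2 * r ^ 4 := by
    have : 0 < r ^ 4 := by positivity
    nlinarith
  filter_upwards [ae_eventually_dyadic_increments_le hW.toIsPreBrownianReal hr hr4 L, hW.cont]
    with ω ⟨k, hk⟩ hc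
  have h1r : 0 < (1 - r)⁻¹ := inv_pos.2 (by linarith)
  refine ⟨3 * (1 - r)⁻¹ * 2 ^ (1 / 8 : ℝ), (1 / 2) ^ k, by positivity, by positivity,
    fun u v hu hv huv => ?_⟩
  rcases eq_or_ne u v with rfl | hne
  · simp only [sub_self, abs_zero]
    positivity
  have hpos : 0 < |(u : ℝ) - v| := abs_pos.2 (sub_ne_zero.2 (by exact_mod_cast hne))
  -- The level with `2^(-j-1) < |u - v| ≤ 2^(-j)`; the lower bound accounts for the factor `2 ^
  -- (1/8)` in the constant.
  obtain ⟨j, hj1, hj2⟩ := exists_nat_pow_near_of_lt_one hpos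
    (huv.trans (pow_le_one₀ (by norm_num) (by norm_num)))
    (show (0 : ℝ) < 1 / 2 by norm_num) (by norm_num)
  have hkj : k ≤ j := by
    have := hj1.trans_le huv
    rw [pow_lt_pow_iff_right_of_lt_one₀ (by norm_num) (by norm_num)] at this
    omega
  refine (abs_sub_le_of_dyadic hc hr hr1 hk hu hv hkj hj2).trans ?_
  rw [mul_assoc _ ((2 : ℝ) ^ (1 / 8 : ℝ)), ← Real.mul_rpow (by norm_num) hpos.le]
  gcongr
  rw [hrdef, ← Real.rpow_natCast, ← Real.rpow_mul (by norm_num), mul_comm (1 / 8 : ℝ),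
    Real.rpow_mul (by norm_num), Real.rpow_natCast]
  gcongr
  rw [pow_succ] at hj1
  linarith

end

/-! ### Realized variation along a Hölder clock: concentration on nets of horizons. -/

section

/-- The sum of the squared increments of `w ∘ J` along the first `N + 1` steps of the grid of mesh
`S / N`. -/
noncomputable def realizedVar (w : ℝ≥0 → ℝ) (J : ℝ → ℝ) (N : ℕ) (S : ℝ) : ℝ :=
  ∑ n ∈ Finset.range (N + 1),
    (w (J (((n : ℝ) + 1) * S / N)).toNNReal - w (J ((n : ℝ) * S / N)).toNNReal) ^ 2

/-- `J` is a time change on `[0, R]`: it starts at `0`, increases, and is Hölder continuous. -/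
structure IsHolderClock (J : ℝ → ℝ) (R C p : ℝ) : Prop where
  zero : J 0 = 0
  const_pos : 0 < C
  exp_pos : 0 < p
  mono : MonotoneOn J (Set.Icc 0 R)
  holder : ∀ s t, 0 ≤ s → s ≤ t → t ≤ R → J t - J s ≤ C * (t - s) ^ p

namespace IsHolderClock

variable {J : ℝ → ℝ} {R C p : ℝ}

lemma nonneg (h : IsHolderClock J R C p) {t : ℝ} (ht : t ∈ Set.Icc 0 R) : 0 ≤ J t := by
  rw [← h.zero]
  exact h.mono ⟨le_rfl, ht.1.trans ht.2⟩ ht ht.1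

lemma abs_sub_le (h : IsHolderClock J R C p) {s t : ℝ} (hs : s ∈ Set.Icc 0 R)
    (ht : t ∈ Set.Icc 0 R) : |J t - J s| ≤ C * |t - s| ^ p := by
  wlog hst : s ≤ t generalizing s t
  · rw [abs_sub_comm, abs_sub_comm t s]
    exact this ht hs (le_of_not_ge hst)
  rw [abs_of_nonneg (sub_nonneg.2 (h.mono hs ht hst)), abs_of_nonneg (sub_nonneg.2 hst)]
  exact h.holder s t hs.1 hst ht.2

lemma continuousOn (h : IsHolderClock J R C p) : ContinuousOn J (Set.Icc 0 R) := by
  intro s hs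
  rw [ContinuousWithinAt, tendsto_iff_dist_tendsto_zero]
  have hlim : Tendsto (fun t : ℝ => C * |t - s| ^ p) (nhdsWithin s (Set.Icc 0 R)) (nhds 0) := by
    have hc : Continuous fun t : ℝ => C * |t - s| ^ p :=
      continuous_const.mul ((continuous_id.sub continuous_const).abs.rpow_const
        fun _ => Or.inr h.exp_pos.le)
    have := (hc.tendsto s).mono_left (nhdsWithin_le_nhds (s := Set.Icc 0 R))
    simpa [Real.zero_rpow h.exp_pos.ne'] using this
  refine squeeze_zero' (Eventually.of_forall fun _ => dist_nonneg) ?_ hlim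
  filter_upwards [self_mem_nhdsWithin] with t ht
  exact h.abs_sub_le hs ht

end IsHolderClock

/-- The sum has `N + 1` steps, so the grid overshoots its horizon by one mesh. This is why clocks
are considered on `[0, 2T]`. -/
lemma grid_mem_Icc {T S : ℝ} (hS : S ∈ Set.Icc 0 T) {N : ℕ} (hN : 1 ≤ N) {x : ℝ} (hx : 0 ≤ x)
    (hx2 : x ≤ N + 1) : x * S / N ∈ Set.Icc 0 (2 * T) := by
  have hN' : (1 : ℝ) ≤ N := by exact_mod_cast hN
  have hT : 0 ≤ T := hS.1.trans hS.2
  refine ⟨div_nonneg (mul_nonneg hx hS.1) (by linarith), ?_⟩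
  rw [div_le_iff₀ (by linarith)]
  calc x * S ≤ (N + 1) * T := mul_le_mul hx2 hS.2 hS.1 (by linarith)
    _ ≤ 2 * T * N := by nlinarith

variable {Ω : Type*} [MeasurableSpace Ω] {P : Measure Ω} {W : ℝ≥0 → Ω → ℝ}
  {J : ℝ → ℝ} {T C p : ℝ}

/-- Each clock increment is at most `M = C (T / N)^p`, so the Chernoff exponent is of order `N^p`,
uniformly in the horizon. -/
lemma measure_realizedVar_sub_ge_le [IsProbabilityMeasure P] (hWm : ∀ t, Measurable (W t))
    (hW : IsPreBrownianReal W P) (hT : 0 < T) (hJ : IsHolderClock J (2 * T) C p)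
    {ε η : ℝ} (hη : 0 ≤ η) (hη4 : η ≤ 1 / 4) (hηL : 8 * η * J (2 * T) ≤ ε)
    {N : ℕ} (hN : 1 ≤ N) {S : ℝ} (hS : S ∈ Set.Icc 0 T) :
    P.real {ω | ε ≤ |realizedVar (W · ω) J N S - J (((N : ℝ) + 1) * S / N)|}
      ≤ 2 * Real.exp (-(η * ε / (2 * (C * T ^ p))) * (N : ℝ) ^ p) := by
  have hN' : (1 : ℝ) ≤ N := by exact_mod_cast hN
  have hC := hJ.const_pos
  -- The Chernoff lemma wants a sequence monotone on all of `ℕ`; the truncation is inactive for the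
  -- indices up to `N + 1` that matter.
  set g : ℕ → ℝ := fun i => min ((i : ℝ) * S / N) (2 * T) with hg
  have hgmem : ∀ i, g i ∈ Set.Icc 0 (2 * T) := fun i =>
    ⟨le_min (div_nonneg (mul_nonneg (Nat.cast_nonneg i) hS.1) (by linarith)) (by linarith),
      min_le_right _ _⟩
  have hgmono : Monotone g := by
    intro i j hij
    have := hS.1
    simp only [hg]
    gcongr
  have hgeq : ∀ i : ℕ, i ≤ N + 1 → g i = (i : ℝ) * S / N := fun i hi =>
    min_eq_left (grid_mem_Icc hS hN (Nat.cast_nonneg i) (by exact_mod_cast hi)).2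
  set u : ℕ → ℝ≥0 := fun i => (J (g i)).toNNReal with hu
  have hucoe : ∀ i, (u i : ℝ) = J (g i) := fun i => Real.coe_toNNReal _ (hJ.nonneg (hgmem i))
  have humono : Monotone u := fun i j hij =>
    Real.toNNReal_mono (hJ.mono (hgmem i) (hgmem j) (hgmono hij))
  have hM : 0 < C * (T / N) ^ p := by positivity
  have hinc : ∀ i < N + 1, (u (i + 1) : ℝ) - u i ≤ C * (T / N) ^ p := by
    intro i hi
    rw [hucoe, hucoe]
    refine (hJ.holder _ _ (hgmem i).1 (hgmono (Nat.le_succ i)) (hgmem _).2).trans ?_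
    have h1 : g (i + 1) - g i = S / N := by
      rw [hgeq i (by omega), hgeq (i + 1) (by omega)]
      push_cast
      ring
    rw [h1]
    have := hS.1
    have := hS.2
    have := hJ.exp_pos
    gcongr
  have key := measure_sum_sq_increments_le (P := P) hWm hW humono (N + 1) hM
    (show (u (N + 1) : ℝ) ≤ J (2 * T) by
      rw [hucoe]
      exact hJ.mono (hgmem _) ⟨by linarith, le_rfl⟩ (hgmem _).2) hinc hη hη4 hηL
  have hsum : ∀ ω, ∑ i ∈ Finset.range (N + 1),
      ((W (u (i + 1)) ω - W (u i) ω) ^ 2 - ((u (i + 1) : ℝ) - u i))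
      = realizedVar (W · ω) J N S - J (((N : ℝ) + 1) * S / N) := by
    intro ω
    rw [Finset.sum_sub_distrib, Finset.sum_range_sub (fun i => (u i : ℝ))]
    congr 1
    · refine Finset.sum_congr rfl fun i hi => ?_
      have hi := Finset.mem_range.1 hi
      simp only [hu]
      rw [hgeq i (by omega), hgeq (i + 1) (by omega)]
      push_cast
      rfl
    · rw [hucoe, hucoe, hgeq 0 (by omega), hgeq (N + 1) le_rfl]
      simp [hJ.zero]
  simp_rw [hsum] at key
  refine key.trans (le_of_eq ?_)
  congr 2
  rw [Real.div_rpow hT.le (by linarith)]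
  have : (N : ℝ) ^ p ≠ 0 := by positivity
  have : T ^ p ≠ 0 := by positivity
  field_simp

lemma summable_pow_mul_exp_neg_rpow {c : ℝ} (hc : 0 < c) (hp : 0 < p) (A : ℕ) :
    Summable fun N : ℕ => ((N : ℝ) ^ A + 1) * (2 * Real.exp (-c * (N : ℝ) ^ p)) := by
  -- The power is chosen so that, evaluated at `N ^ p`, it is `N ^ (-(A + 2))`: it absorbs the `N ^
  -- A` net points and leaves `N ^ (-2)`.
  have h1 := (isLittleO_exp_neg_mul_rpow_atTop hc (-((A : ℝ) + 2) / p)).comp_tendsto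
    ((tendsto_rpow_atTop hp).comp tendsto_natCast_atTop_atTop)
  refine summable_of_isBigO_nat (g := fun N : ℕ => 4 * ((N : ℝ) ^ 2)⁻¹)
    ((Real.summable_nat_pow_inv.2 one_lt_two).mul_left 4) ?_
  refine Asymptotics.IsBigO.of_bound 1 ?_
  filter_upwards [h1.bound one_pos, eventually_ge_atTop 1] with N hN hN1
  have hN' : (1 : ℝ) ≤ N := by exact_mod_cast hN1
  simp only [Function.comp, one_mul, Real.norm_eq_abs, Real.abs_exp] at hN
  rw [← Real.rpow_mul (by positivity), mul_div_cancel₀ _ hp.ne', abs_of_pos (by positivity),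
    Real.rpow_neg (by positivity), Real.rpow_add (by positivity), Real.rpow_natCast,
    Real.rpow_two] at hN
  rw [one_mul, Real.norm_of_nonneg (by positivity), Real.norm_of_nonneg (by positivity)]
  have hA : 1 ≤ (N : ℝ) ^ A := one_le_pow₀ hN'
  calc ((N : ℝ) ^ A + 1) * (2 * Real.exp (-c * (N : ℝ) ^ p))
      ≤ (2 * (N : ℝ) ^ A) * (2 * ((N : ℝ) ^ A * (N : ℝ) ^ 2)⁻¹) := by
        gcongr
        linarith
    _ = _ := by
        field_simp
        norm_num

/-- Along polynomially fine nets of horizons, the realized variation is almost surely uniformly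
close to its mean. -/
lemma ae_eventually_realizedVar_net [IsProbabilityMeasure P] (hWm : ∀ t, Measurable (W t))
    (hW : IsPreBrownianReal W P) (hT : 0 < T) (hJ : IsHolderClock J (2 * T) C p)
    {ε : ℝ} (hε : 0 < ε) (A : ℕ) :
    ∀ᵐ ω ∂P, ∀ᶠ N : ℕ in atTop, ∀ l : ℕ, l ≤ N ^ A →
      |realizedVar (W · ω) J N (l * T / N ^ A)
        - J (((N : ℝ) + 1) * (l * T / N ^ A) / N)| < ε := by
  have hC := hJ.const_pos
  have hL : 0 ≤ J (2 * T) := hJ.nonneg ⟨by linarith, le_rfl⟩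
  obtain ⟨η, hη0, hη4, hηL⟩ : ∃ η : ℝ, 0 < η ∧ η ≤ 1 / 4 ∧ 8 * η * J (2 * T) ≤ ε := by
    -- The `+ 1` covers a clock that vanishes on the whole window.
    refine ⟨min (1 / 4) (ε / (8 * (J (2 * T) + 1))), by positivity, min_le_left _ _, ?_⟩
    calc 8 * min (1 / 4) (ε / (8 * (J (2 * T) + 1))) * J (2 * T)
        ≤ 8 * (ε / (8 * (J (2 * T) + 1))) * (J (2 * T) + 1) := by
          gcongr
          · exact min_le_right _ _
          · linarith
      _ = ε := by field_simp
  set c := η * ε / (2 * (C * T ^ p)) with hc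
  have hcpos : 0 < c := by positivity
  set B : ℕ → Set Ω := fun N => if 1 ≤ N then ⋃ l ∈ Finset.range (N ^ A + 1),
    {ω | ε ≤ |realizedVar (W · ω) J N (l * T / N ^ A)
        - J (((N : ℝ) + 1) * (l * T / N ^ A) / N)|} else ∅ with hB
  have hBle : ∀ N, P.real (B N) ≤ ((N : ℝ) ^ A + 1) * (2 * Real.exp (-c * (N : ℝ) ^ p)) := by
    intro N
    by_cases hN : 1 ≤ N
    · have hNA : (0 : ℝ) < (N : ℝ) ^ A := by positivity
      simp only [hB, if_pos hN]
      refine (measureReal_biUnion_finset_le _ _).trans ?_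
      calc _ ≤ ∑ l ∈ Finset.range (N ^ A + 1), 2 * Real.exp (-c * (N : ℝ) ^ p) := by
            refine Finset.sum_le_sum fun l hl => ?_
            refine measure_realizedVar_sub_ge_le hWm hW hT hJ hη0.le hη4 hηL hN ⟨by positivity, ?_⟩
            rw [div_le_iff₀ hNA, mul_comm]
            gcongr
            exact_mod_cast Nat.lt_succ_iff.1 (Finset.mem_range.1 hl)
        _ = _ := by
            rw [Finset.sum_const, Finset.card_range, nsmul_eq_mul]
            push_cast
            rfl
    · simp only [hB, if_neg hN, measureReal_empty]
      positivity
  have hsum : ∑' N, P (B N) ≠ ∞ := by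
    have := (Summable.of_nonneg_of_le (fun _ => measureReal_nonneg) hBle
      (summable_pow_mul_exp_neg_rpow hcpos hJ.exp_pos A)).tsum_ofReal_ne_top
    simpa only [ofReal_measureReal (measure_ne_top _ _)] using this
  filter_upwards [ae_eventually_notMem hsum] with ω hω
  filter_upwards [hω, eventually_ge_atTop 1] with N hN hN1 l hl
  simp only [hB, if_pos hN1, Set.mem_iUnion, Finset.mem_range, not_exists, Set.mem_ofPred_eq,
    not_le] at hN
  exact hN l (by omega)

end

/-! ### From nets to all horizons: uniform convergence of the realized variation. -/

section

/-- If increments change by `x` with `|x| ≤ 2 d`, squares change by `x² + 2 y x`. The bound `|2 y| ≤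
1 + y²` lets the realized variation itself control the cross terms. -/
lemma abs_realizedVar_sub_le {w : ℝ≥0 → ℝ} {J : ℝ → ℝ} {N : ℕ} {S S' d : ℝ}
    (h : ∀ n : ℕ, n ≤ N + 1 →
      |w (J ((n : ℝ) * S / N)).toNNReal - w (J ((n : ℝ) * S' / N)).toNNReal| ≤ d) :
    |realizedVar w J N S - realizedVar w J N S'|
      ≤ ((N : ℝ) + 1) * (4 * d ^ 2 + 2 * d) + 2 * d * realizedVar w J N S' := by
  have hd : 0 ≤ d := (abs_nonneg _).trans (h 0 (by omega))
  simp only [realizedVar]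
  rw [← Finset.sum_sub_distrib, Finset.mul_sum]
  refine (Finset.abs_sum_le_sum_abs _ _).trans ?_
  calc _ ≤ ∑ n ∈ Finset.range (N + 1), ((4 * d ^ 2 + 2 * d) + 2 * d *
        (w (J (((n : ℝ) + 1) * S' / N)).toNNReal - w (J ((n : ℝ) * S' / N)).toNNReal) ^ 2) := by
        refine Finset.sum_le_sum fun n hn => ?_
        have hn := Finset.mem_range.1 hn
        have h1 := abs_le.1 (h n (by omega))
        have h2 := h (n + 1) (by omega)
        push_cast at h2
        have h2 := abs_le.1 h2
        set a := w (J (((n : ℝ) + 1) * S / N)).toNNReal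
        set b := w (J ((n : ℝ) * S / N)).toNNReal
        set a' := w (J (((n : ℝ) + 1) * S' / N)).toNNReal
        set b' := w (J ((n : ℝ) * S' / N)).toNNReal
        set x := (a - b) - (a' - b')
        set y := a' - b'
        have hx : |x| ≤ 2 * d := abs_le.2 ⟨by simp only [x]; linarith, by simp only [x]; linarith⟩
        have h3 : (a - b) ^ 2 - y ^ 2 = x ^ 2 + 2 * y * x := by simp only [x, y]; ring
        have h4 : x ^ 2 ≤ 4 * d ^ 2 := by
          rw [← sq_abs]
          nlinarith [abs_nonneg x]
        have h5 : |2 * y * x| ≤ (1 + y ^ 2) * (2 * d) := by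
          rw [abs_mul]
          have : |2 * y| ≤ 1 + y ^ 2 := by
            rw [abs_le]
            constructor <;> nlinarith [sq_nonneg (y - 1), sq_nonneg (y + 1)]
          gcongr
        rw [h3]
        refine (abs_add_le _ _).trans ?_
        rw [abs_of_nonneg (sq_nonneg x)]
        linarith
    _ = _ := by
        rw [Finset.sum_add_distrib, Finset.sum_const, Finset.card_range, nsmul_eq_mul]
        push_cast
        rfl

/-- Net points are `T / N^A` apart. By `hA`, the composed Hölder exponent `p / 8` turns this into
path differences of order `N^(-2)`, which beat the `N + 1` summands. -/
lemma eventually_forall_abs_realizedVar_sub_le {w : ℝ≥0 → ℝ} {J : ℝ → ℝ} {T C p K δ ε : ℝ}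
    {A L : ℕ} (hT : 0 < T) (hJ : IsHolderClock J (2 * T) C p) (hL : J (2 * T) < L)
    (hA : 2 ≤ A * p * (1 / 8)) (hK : 0 < K) (hδ : 0 < δ)
    (hw : ∀ u v : ℝ≥0, u < L → v < L → |(u : ℝ) - v| ≤ δ →
      |w u - w v| ≤ K * |(u : ℝ) - v| ^ (1 / 8 : ℝ))
    (hε : 0 < ε)
    (hnet : ∀ᶠ N : ℕ in atTop, ∀ l : ℕ, l ≤ N ^ A →
      |realizedVar w J N (l * T / N ^ A) - J (((N : ℝ) + 1) * (l * T / N ^ A) / N)| < ε) :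
    ∀ᶠ N : ℕ in atTop, ∀ S ∈ Set.Icc 0 T, |realizedVar w J N S - J S| ≤ 2 * ε := by
  have hC := hJ.const_pos
  have hp := hJ.exp_pos
  set K' := K * (C * (2 * T) ^ p) ^ (1 / 8 : ℝ) with hK'
  have hK'pos : 0 < K' := by positivity
  set M := J (2 * T) + ε with hM
  have hMpos : 0 < M := add_pos_of_nonneg_of_pos (hJ.nonneg ⟨by linarith, le_rfl⟩) hε
  -- The total error: moving to the net point, the net error `ε`, and the clock difference between
  -- the overshot net horizon and `S`.
  have hlim : Tendsto (fun N : ℕ => 2 * (K' * (N : ℝ)⁻¹) * (4 * (K' * (N : ℝ)⁻¹) + 2)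
      + 2 * (K' * (N : ℝ)⁻¹) * M + ε + C * (2 * T * (N : ℝ)⁻¹) ^ p) atTop (nhds ε) := by
    have hc : Continuous fun x : ℝ => 2 * (K' * x) * (4 * (K' * x) + 2)
      + 2 * (K' * x) * M + ε + C * (2 * T * x) ^ p := by
      have : Continuous fun x : ℝ => (2 * T * x) ^ p :=
        (continuous_const.mul continuous_id).rpow_const fun _ => Or.inr hp.le
      fun_prop
    have h0 := (hc.tendsto 0).comp (tendsto_inv_atTop_nhds_zero_nat (𝕜 := ℝ))
    simpa [Function.comp_def, Real.zero_rpow hp.ne'] using h0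
  have hlimδ : Tendsto (fun N : ℕ => C * (2 * T * (N : ℝ)⁻¹) ^ p) atTop (nhds 0) := by
    have hc : Continuous fun x : ℝ => C * (2 * T * x) ^ p :=
      continuous_const.mul
        ((continuous_const.mul continuous_id).rpow_const fun _ => Or.inr hp.le)
    have h0 := (hc.tendsto 0).comp (tendsto_inv_atTop_nhds_zero_nat (𝕜 := ℝ))
    simpa [Function.comp_def, Real.zero_rpow hp.ne'] using h0
  have hA1 : 1 ≤ A := by
    rcases Nat.eq_zero_or_pos A with h | h
    · rw [h] at hA
      norm_num at hA
    · exact h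
  filter_upwards [hnet, eventually_ge_atTop 1, hlim.eventually_le_const (by linarith : ε < 2 * ε),
    hlimδ.eventually_le_const hδ] with N hnetN hN hle hleδ S hS
  have hN' : (1 : ℝ) ≤ N := by exact_mod_cast hN
  have hNpos : (0 : ℝ) < N := by linarith
  have hNA : (0 : ℝ) < (N : ℝ) ^ A := by positivity
  have hNNA : (N : ℝ) ≤ (N : ℝ) ^ A := le_self_pow₀ hN' (by omega)
  -- Index of the last net point not exceeding `S`.
  set l := ⌊S * N ^ A / T⌋₊ with hl
  have hl1 : (l : ℝ) ≤ S * N ^ A / T :=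
    Nat.floor_le (div_nonneg (mul_nonneg hS.1 hNA.le) hT.le)
  have hl2 : S * N ^ A / T < l + 1 := Nat.lt_floor_add_one _
  have hlA : l ≤ N ^ A := by
    have : (l : ℝ) ≤ (N : ℝ) ^ A := by
      refine hl1.trans ?_
      rw [div_le_iff₀ hT, mul_comm]
      gcongr
      exact hS.2
    exact_mod_cast this
  set S' : ℝ := l * T / N ^ A with hS'
  have hS'0 : 0 ≤ S' := by positivity
  have hS'S : S' ≤ S := by
    rw [hS', div_le_iff₀ hNA]
    rwa [le_div_iff₀ hT] at hl1
  have hSS' : S - S' ≤ T / N ^ A := by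
    rw [hS', sub_le_iff_le_add, ← add_div, le_div_iff₀ hNA]
    rw [div_lt_iff₀ hT] at hl2
    linarith
  have hS'mem : S' ∈ Set.Icc 0 T := ⟨hS'0, hS'S.trans hS.2⟩
  have hJbound : ∀ t ∈ Set.Icc 0 (2 * T), (J t).toNNReal < (L : ℝ≥0) ∧
      ((J t).toNNReal : ℝ) = J t := by
    intro t ht
    refine ⟨?_, Real.coe_toNNReal _ (hJ.nonneg ht)⟩
    rw [← NNReal.coe_lt_coe, Real.coe_toNNReal _ (hJ.nonneg ht)]
    exact (hJ.mono ht ⟨by linarith, le_rfl⟩ ht.2).trans_lt (by exact_mod_cast hL)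
  have hd : ∀ n : ℕ, n ≤ N + 1 →
      |w (J ((n : ℝ) * S / N)).toNNReal - w (J ((n : ℝ) * S' / N)).toNNReal|
        ≤ K' * ((N : ℝ) ^ 2)⁻¹ := by
    intro n hn
    have hn' : (n : ℝ) ≤ N + 1 := by exact_mod_cast hn
    have m1 := grid_mem_Icc hS hN (Nat.cast_nonneg n) hn'
    have m2 := grid_mem_Icc hS'mem hN (Nat.cast_nonneg n) hn'
    obtain ⟨hu1, hu2⟩ := hJbound _ m1
    obtain ⟨hv1, hv2⟩ := hJbound _ m2
    have hdiff : |J ((n : ℝ) * S / N) - J ((n : ℝ) * S' / N)| ≤ C * (2 * T / N ^ A) ^ p := by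
      refine (hJ.abs_sub_le m2 m1).trans ?_
      have h1 : (n : ℝ) * S / N - n * S' / N = n / N * (S - S') := by ring
      have h2 : (n : ℝ) / N ≤ 2 := by
        rw [div_le_iff₀ hNpos]
        linarith
      rw [h1, abs_of_nonneg (mul_nonneg (by positivity) (by linarith))]
      have h3 : (n : ℝ) / N * (S - S') ≤ 2 * T / N ^ A := by
        calc (n : ℝ) / N * (S - S') ≤ 2 * (T / N ^ A) :=
              mul_le_mul h2 hSS' (by linarith) (by norm_num)
          _ = _ := by ring
      have : 0 ≤ (n : ℝ) / N * (S - S') := mul_nonneg (by positivity) (by linarith)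
      gcongr
    have hsmall : C * (2 * T / N ^ A) ^ p ≤ δ := by
      refine le_trans ?_ hleδ
      rw [← div_eq_mul_inv]
      gcongr
    have := hw _ _ hu1 hv1 (by rw [hu2, hv2]; exact hdiff.trans hsmall)
    rw [hu2, hv2] at this
    refine this.trans ?_
    rw [hK', mul_assoc]
    gcongr
    calc |J ((n : ℝ) * S / N) - J ((n : ℝ) * S' / N)| ^ (1 / 8 : ℝ)
        ≤ (C * (2 * T / N ^ A) ^ p) ^ (1 / 8 : ℝ) := by gcongr
      _ = (C * (2 * T) ^ p) ^ (1 / 8 : ℝ) * ((N : ℝ) ^ (A * p * (1 / 8)))⁻¹ := by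
          rw [Real.div_rpow (by positivity) hNA.le, ← mul_div_assoc,
            Real.div_rpow (by positivity) (by positivity), Real.rpow_mul hNpos.le,
            Real.rpow_mul hNpos.le, Real.rpow_natCast, div_eq_mul_inv]
      _ ≤ _ := by
          gcongr
          rw [← Real.rpow_two]
          exact Real.rpow_le_rpow_of_exponent_le hN' hA
  have hRV := abs_realizedVar_sub_le hd
  have hnetl := hnetN l hlA
  rw [← hS'] at hnetl
  have mN1 : ((N : ℝ) + 1) * S' / N ∈ Set.Icc 0 (2 * T) :=
    grid_mem_Icc hS'mem hN (by positivity) le_rfl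
  have mS : S ∈ Set.Icc 0 (2 * T) := ⟨hS.1, by linarith [hS.2]⟩
  have hJ1 : |J (((N : ℝ) + 1) * S' / N) - J S| ≤ C * (2 * T * (N : ℝ)⁻¹) ^ p := by
    refine (hJ.abs_sub_le mS mN1).trans ?_
    have h1 : ((N : ℝ) + 1) * S' / N - S = S' * (N : ℝ)⁻¹ - (S - S') := by
      field_simp
      ring
    have h2 : S' * (N : ℝ)⁻¹ ≤ T * (N : ℝ)⁻¹ := by
      gcongr
      exact hS'mem.2
    have h3 : T / (N : ℝ) ^ A ≤ T * (N : ℝ)⁻¹ := by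
      rw [← div_eq_mul_inv]
      gcongr
    have h4 : 0 ≤ S' * (N : ℝ)⁻¹ := by positivity
    have h5 : |((N : ℝ) + 1) * S' / N - S| ≤ 2 * T * (N : ℝ)⁻¹ := by
      rw [h1, abs_le]
      constructor <;> nlinarith
    gcongr
  have hRVM : realizedVar w J N S' ≤ M := by
    have h1 := (abs_lt.1 hnetl).2
    have h2 := hJ.mono mN1 ⟨by linarith, le_rfl⟩ mN1.2
    linarith
  have e1 : K' * ((N : ℝ) ^ 2)⁻¹ ≤ K' * (N : ℝ)⁻¹ := by
    gcongr
    exact le_self_pow₀ hN' (by norm_num)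
  have e2 : ((N : ℝ) + 1) * (K' * ((N : ℝ) ^ 2)⁻¹) ≤ 2 * (K' * (N : ℝ)⁻¹) := by
    calc ((N : ℝ) + 1) * (K' * ((N : ℝ) ^ 2)⁻¹) ≤ (2 * N) * (K' * ((N : ℝ) ^ 2)⁻¹) := by
          gcongr
          linarith
      _ = _ := by field_simp
  have e3 : ((N : ℝ) + 1) * (4 * (K' * ((N : ℝ) ^ 2)⁻¹) ^ 2 + 2 * (K' * ((N : ℝ) ^ 2)⁻¹))
      ≤ 2 * (K' * (N : ℝ)⁻¹) * (4 * (K' * (N : ℝ)⁻¹) + 2) := by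
    calc _ = (((N : ℝ) + 1) * (K' * ((N : ℝ) ^ 2)⁻¹)) * (4 * (K' * ((N : ℝ) ^ 2)⁻¹) + 2) := by
          ring
      _ ≤ _ := by gcongr
  have e4 : 2 * (K' * ((N : ℝ) ^ 2)⁻¹) * realizedVar w J N S' ≤ 2 * (K' * (N : ℝ)⁻¹) * M := by
    have h0 : 0 ≤ realizedVar w J N S' := Finset.sum_nonneg fun _ _ => sq_nonneg _
    gcongr
  calc |realizedVar w J N S - J S|
      ≤ |realizedVar w J N S - realizedVar w J N S'|
        + |realizedVar w J N S' - J (((N : ℝ) + 1) * S' / N)|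
        + |J (((N : ℝ) + 1) * S' / N) - J S| := by
        refine (_root_.abs_sub_le _ (J (((N : ℝ) + 1) * S' / N)) _).trans ?_
        gcongr
        exact _root_.abs_sub_le _ _ _
    _ ≤ 2 * ε := by linarith

/-- The realized variation of a time-changed Brownian motion converges almost surely to the clock,
uniformly in the horizon. -/
theorem ae_tendsto_realizedVar {Ω : Type*} [MeasurableSpace Ω] {P : Measure Ω}
    [IsProbabilityMeasure P] {W : ℝ≥0 → Ω → ℝ} (hWm : ∀ t, Measurable (W t))
    (hW : IsBrownianReal W P) {J : ℝ → ℝ} {T C p : ℝ} (hT : 0 < T)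
    (hJ : IsHolderClock J (2 * T) C p) :
    ∀ᵐ ω ∂P, ∀ ε > 0, ∀ᶠ N : ℕ in atTop, ∀ S ∈ Set.Icc 0 T,
      |realizedVar (W · ω) J N S - J S| ≤ ε := by
  obtain ⟨L, hL⟩ := exists_nat_gt (J (2 * T))
  obtain ⟨A, hA⟩ := exists_nat_ge (16 / p)
  have hA' : 2 ≤ A * p * (1 / 8) := by
    rw [div_le_iff₀ hJ.exp_pos] at hA
    linarith
  have hnet : ∀ᵐ ω ∂P, ∀ k : ℕ, ∀ᶠ N : ℕ in atTop, ∀ l : ℕ, l ≤ N ^ A →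
      |realizedVar (W · ω) J N (l * T / N ^ A)
        - J (((N : ℝ) + 1) * (l * T / N ^ A) / N)| < 1 / ((k : ℝ) + 1) :=
    ae_all_iff.2 fun k => ae_eventually_realizedVar_net hWm hW.toIsPreBrownianReal hT hJ
      (by positivity) A
  filter_upwards [hnet, ae_exists_holder hW L] with ω h1 ⟨K, δ, hK, hδ, h2⟩ ε hε
  obtain ⟨k, hk⟩ := exists_nat_one_div_lt (show 0 < ε / 2 by linarith)
  filter_upwards [eventually_forall_abs_realizedVar_sub_le hT hJ hL hA' hK hδ h2
    (by positivity) (h1 k)] with N hN S hS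
  exact (hN S hS).trans (by linarith)

end

/-! ### The shock clock and the maximum of its increment quotient. -/

section

/-- The `p`-th power of the time spent in `[a, b]` up to time `t`. -/
noncomputable def clippedPow (p a b t : ℝ) : ℝ := (max 0 (min t b - a)) ^ p

lemma clippedPow_mono {p a b : ℝ} (hp : 0 < p) : Monotone (clippedPow p a b) := by
  intro s t hst
  simp only [clippedPow]
  gcongr

/-- Clipping is 1-Lipschitz and `x ^ p` is subadditive for `p ≤ 1`. -/
lemma clippedPow_sub_le {p a b s t : ℝ} (hp : 0 < p) (hp1 : p ≤ 1) (hst : s ≤ t) :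
    clippedPow p a b t - clippedPow p a b s ≤ (t - s) ^ p := by
  simp only [clippedPow]
  set A := max 0 (min s b - a)
  set B := max 0 (min t b - a)
  have hA : 0 ≤ A := le_max_left _ _
  have hB : 0 ≤ B := le_max_left _ _
  have hBA : B ≤ A + (t - s) := by
    apply max_le (by linarith)
    have h1 : min t b ≤ min s b + (t - s) := by
      rw [← min_add_add_right]
      exact min_le_min (by linarith) (by linarith)
    have h2 : min s b - a ≤ A := le_max_right _ _
    linarith
  have h1 : B ^ p ≤ (A + (t - s)) ^ p := by gcongr
  have h2 := Real.rpow_add_le_add_rpow hA (sub_nonneg.2 hst) hp.le hp1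
  linarith

variable {Ω : Type*} {τ : ℤ → Ω → ℝ} {ω : Ω} {D σ T t : ℝ}

lemma shockIndex_eq_of_mem (hmono : StrictMono fun n => τ n ω) {k : ℕ} (h1 : τ k ω ≤ t)
    (h2 : t < τ ((k : ℤ) + 1) ω) : shockIndex τ t ω = k := by
  have : {n : ℕ | τ (n : ℤ) ω ≤ t} = Set.Iic k := by
    ext n
    simp only [Set.mem_ofPred_eq, Set.mem_Iic]
    constructor
    · intro hn
      have := hmono.lt_iff_lt.1 (hn.trans_lt h2)
      omega
    · intro hn
      exact (hmono.monotone (by exact_mod_cast hn)).trans h1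
  rw [shockIndex, this, csSup_Iic]

/-- A configuration of shocks with the properties that hold almost surely. -/
structure IsRegularConfig (τ : ℤ → Ω → ℝ) (T : ℝ) (ω : Ω) : Prop where
  strictMono : StrictMono fun n => τ n ω
  tendsto_atTop : Tendsto (fun n => τ n ω) atTop atTop
  neg : τ 0 ω < 0
  pos : 0 < τ 1 ω
  ne : ∀ n, τ n ω ≠ T

namespace IsRegularConfig

lemma shockIndex_spec (h : IsRegularConfig τ T ω) (ht : 0 ≤ t) :
    τ (shockIndex τ t ω) ω ≤ t ∧ t < τ ((shockIndex τ t ω : ℤ) + 1) ω := by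
  have hex : ∃ n : ℕ, t < τ n ω := by
    obtain ⟨N, hN⟩ := (h.tendsto_atTop.eventually_gt_atTop t).exists_forall_of_atTop
    exact ⟨N.toNat, hN _ (Int.self_le_toNat N)⟩
  classical
  have h0 : Nat.find hex ≠ 0 := by
    intro h0
    have := Nat.find_spec hex
    rw [h0] at this
    have := h.neg
    push_cast at *
    linarith
  obtain ⟨k, hk⟩ := Nat.exists_eq_succ_of_ne_zero h0
  have h1 : τ k ω ≤ t := not_lt.1 (Nat.find_min hex (by omega))
  have h2 : t < τ ((k : ℤ) + 1) ω := by
    have := Nat.find_spec hex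
    rw [hk] at this
    exact_mod_cast this
  rw [shockIndex_eq_of_mem h.strictMono h1 h2]
  exact ⟨h1, h2⟩

/-- The number of summands no longer depends on `t`, so monotonicity and Hölder continuity of the
clock on a bounded window can be checked term by term, across shocks included. -/
lemma timeChange_eq_sum_clippedPow (h : IsRegularConfig τ T ω) (hD : 0 < D) (ht : 0 ≤ t) {n : ℕ}
    (hn : t < τ ((n : ℤ) + 1) ω) :
    timeChange D σ τ t ω = σ ^ 2 * (∑ k ∈ Finset.range (n + 1),
      clippedPow (2 * D) (τ k ω) (τ ((k : ℤ) + 1) ω) t - (-τ 0 ω) ^ (2 * D)) := by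
  obtain ⟨h1, h2⟩ := h.shockIndex_spec ht
  have hin : shockIndex τ t ω ≤ n := by
    have := h.strictMono.lt_iff_lt.1 (h1.trans_lt hn)
    omega
  rw [timeChange]
  set i := shockIndex τ t ω
  have hsub : ∑ k ∈ Finset.range (i + 1),
      clippedPow (2 * D) (τ k ω) (τ ((k : ℤ) + 1) ω) t = ∑ k ∈ Finset.range (n + 1),
      clippedPow (2 * D) (τ k ω) (τ ((k : ℤ) + 1) ω) t := by
    apply Finset.sum_subset
    · intro k hk
      rw [Finset.mem_range] at *
      omega
    · intro k _ hk
      rw [Finset.mem_range] at hk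
      have : τ ((i : ℤ) + 1) ω ≤ τ k ω := h.strictMono.monotone (by omega)
      have h3 : min t (τ ((k : ℤ) + 1) ω) ≤ t := min_le_left _ _
      rw [clippedPow, max_eq_left (by linarith), Real.zero_rpow (by positivity)]
  have hi : clippedPow (2 * D) (τ i ω) (τ ((i : ℤ) + 1) ω) t = (t - τ i ω) ^ (2 * D) := by
    rw [clippedPow, min_eq_left h2.le, max_eq_right (by linarith)]
  have hlt : ∀ j ≤ i, ∑ k ∈ Finset.range j,
      clippedPow (2 * D) (τ k ω) (τ ((k : ℤ) + 1) ω) t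
      = ∑ k ∈ Finset.Icc 1 j, (τ (k : ℤ) ω - τ ((k : ℤ) - 1) ω) ^ (2 * D) := by
    intro j
    induction j with
    | zero => simp
    | succ j ih =>
      intro hj
      rw [Finset.sum_range_succ, ih (by omega), Finset.sum_Icc_succ_top (by omega)]
      congr 1
      have h4 : τ ((j : ℤ) + 1) ω ≤ τ i ω := h.strictMono.monotone (by omega)
      have h5 : τ j ω < τ ((j : ℤ) + 1) ω := h.strictMono (by omega)
      push_cast
      rw [clippedPow, min_eq_right (h4.trans h1), max_eq_right (by linarith), add_sub_cancel_right]
  rw [← hsub, Finset.sum_range_succ, hlt i le_rfl, hi]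
  ring

lemma isHolderClock (h : IsRegularConfig τ T ω) (hD0 : 0 < D) (hD : D < 1 / 2) (hσ : 0 < σ)
    {R : ℝ} (hR : 0 ≤ R) :
    ∃ C, IsHolderClock (fun t => timeChange D σ τ t ω) R C (2 * D) := by
  have hp : 0 < 2 * D := by linarith
  obtain ⟨-, hn⟩ := h.shockIndex_spec hR
  set n := shockIndex τ R ω
  have heq : ∀ s ∈ Set.Icc 0 R, timeChange D σ τ s ω = σ ^ 2 * (∑ k ∈ Finset.range (n + 1),
      clippedPow (2 * D) (τ k ω) (τ ((k : ℤ) + 1) ω) s - (-τ 0 ω) ^ (2 * D)) := fun s hs =>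
    h.timeChange_eq_sum_clippedPow hD0 hs.1 (hs.2.trans_lt hn)
  refine ⟨σ ^ 2 * (n + 1), ?_, by positivity, hp, ?_, ?_⟩
  · have h0 : shockIndex τ 0 ω = 0 :=
      shockIndex_eq_of_mem h.strictMono (by exact_mod_cast h.neg.le) (by simpa using h.pos)
    simp [timeChange, h0]
  · intro s hs t ht hst
    simp only [heq s hs, heq t ht]
    gcongr
    exact clippedPow_mono hp hst
  · intro s t hs hst ht
    rw [heq s ⟨hs, hst.trans ht⟩, heq t ⟨hs.trans hst, ht⟩, ← mul_sub, sub_sub_sub_cancel_right,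
      ← Finset.sum_sub_distrib, mul_assoc]
    gcongr
    calc _ ≤ ∑ k ∈ Finset.range (n + 1), (t - s) ^ (2 * D) :=
          Finset.sum_le_sum fun k _ => clippedPow_sub_le hp (by linarith) hst
      _ = _ := by
          rw [Finset.sum_const, Finset.card_range, nsmul_eq_mul]
          push_cast
          rfl

lemma timeSinceShock_pos (h : IsRegularConfig τ T ω) (hT : 0 < T) : 0 < timeSinceShock τ T ω := by
  have h1 := (h.shockIndex_spec hT.le).1
  have h2 := h.ne (shockIndex τ T ω)
  rw [timeSinceShock, sub_pos]
  exact lt_of_le_of_ne h1 h2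

lemma timeSinceShock_lt (h : IsRegularConfig τ T ω) (hi : 1 ≤ shockIndex τ T ω) :
    timeSinceShock τ T ω < T := by
  have : τ 1 ω ≤ τ (shockIndex τ T ω) ω := h.strictMono.monotone (by exact_mod_cast hi)
  have := h.pos
  rw [timeSinceShock]
  linarith

lemma timeChange_sub_of_le (h : IsRegularConfig τ T ω) (hT : 0 < T) (ht0 : 0 ≤ t)
    (ht : t ≤ timeSinceShock τ T ω) :
    timeChange D σ τ T ω - timeChange D σ τ (T - t) ω
      = σ ^ 2 * (timeSinceShock τ T ω ^ (2 * D) - (timeSinceShock τ T ω - t) ^ (2 * D)) := by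
  obtain ⟨h1, h2⟩ := h.shockIndex_spec hT.le
  have h3 : shockIndex τ (T - t) ω = shockIndex τ T ω := by
    apply shockIndex_eq_of_mem h.strictMono
    · rw [timeSinceShock] at ht
      linarith
    · linarith
  have h4 : T - t - τ (shockIndex τ T ω) ω = timeSinceShock τ T ω - t := by
    rw [timeSinceShock]
    ring
  rw [timeChange, timeChange, h3, h4, ← timeSinceShock]
  ring

lemma timeChange_sub_of_lt (h : IsRegularConfig τ T ω) (hT : 0 < T)
    (hi : 1 ≤ shockIndex τ T ω) (ht : timeSinceShock τ T ω < t)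
    (ht2 : t ≤ timeSinceShock τ T ω + lastGap τ T ω) :
    timeChange D σ τ T ω - timeChange D σ τ (T - t) ω
      = σ ^ 2 * (timeSinceShock τ T ω ^ (2 * D) + lastGap τ T ω ^ (2 * D)
        - (lastGap τ T ω - (t - timeSinceShock τ T ω)) ^ (2 * D)) := by
  obtain ⟨h1, h2⟩ := h.shockIndex_spec hT.le
  obtain ⟨j, hj⟩ := Nat.exists_eq_add_of_le' hi
  have hj' : ((shockIndex τ T ω : ℕ) : ℤ) - 1 = j := by
    rw [hj]
    push_cast
    ring
  have h3 : shockIndex τ (T - t) ω = j := by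
    apply shockIndex_eq_of_mem h.strictMono
    · rw [timeSinceShock, lastGap, hj'] at ht2
      linarith
    · rw [timeSinceShock, hj] at ht
      push_cast at ht
      linarith
  have h4 : T - t - τ j ω = lastGap τ T ω - (t - timeSinceShock τ T ω) := by
    rw [timeSinceShock, lastGap, hj']
    ring
  rw [timeChange, timeChange, h3, h4, ← timeSinceShock, hj, Finset.sum_Icc_succ_top (by omega),
    ← hj, ← lastGap]
  ring

end IsRegularConfig

lemma gapConst_pos (hD0 : 0 < D) : 0 < gapConst D := by
  rw [gapConst]
  positivity

/-- The defining role of `K`: it gives `2D (m / K)^(2D-1) = m^(2D-1)`, so `m / K` is the age at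
which the power clock has slope `m^(2D-1)`. -/
lemma gapConst_rpow (hD0 : 0 < D) (hD : D < 1 / 2) : gapConst D ^ (1 - 2 * D) = 1 / (2 * D) := by
  have : 1 - 2 * D ≠ 0 := by linarith
  rw [gapConst, ← Real.rpow_mul (by positivity), one_div_mul_cancel this, Real.rpow_one]

/-- On the last interval without shocks, the increment quotient of the power clock stays below its
value at the last shock. -/
lemma rpow_sub_rpow_lt {m : ℝ} (hD : D < 1 / 2) (ht0 : 0 < t)
    (ht : t < m) :
    m ^ (2 * D) - (m - t) ^ (2 * D) < t * m ^ (2 * D - 1) := by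
  have hm : 0 < m := ht0.trans ht
  -- After rescaling by `m`, the claim is `s < s ^ (2D)` for `0 < s < 1`.
  set s := (m - t) / m with hs
  have hs0 : 0 < s := div_pos (by linarith) hm
  have hs1 : s < 1 := (div_lt_one hm).2 (by linarith)
  have h1 : s < s ^ (2 * D) := by
    simpa using Real.rpow_lt_rpow_of_exponent_gt hs0 hs1 (by linarith : 2 * D < 1)
  have h2 : (m - t) ^ (2 * D) = s ^ (2 * D) * m ^ (2 * D) := by
    rw [← Real.mul_rpow hs0.le hm.le, hs, div_mul_cancel₀ _ hm.ne']
  have h3 : m ^ (2 * D) = m * m ^ (2 * D - 1) := by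
    rw [Real.rpow_sub_one hm.ne']
    field_simp
  have h4 : t = m - s * m := by
    rw [hs]
    field_simp
    ring
  rw [h2]
  have h5 : 0 < m ^ (2 * D - 1) := by positivity
  calc m ^ (2 * D) - s ^ (2 * D) * m ^ (2 * D) = (1 - s ^ (2 * D)) * (m * m ^ (2 * D - 1)) := by
        rw [← h3]
        ring
    _ < (1 - s) * (m * m ^ (2 * D - 1)) := by gcongr
    _ = t * m ^ (2 * D - 1) := by linear_combination (-(m ^ (2 * D - 1))) * h4

/-- The power clock started one gap before the last shock grows more slowly, near the shock, than
the linear rate `m ^ (2 D - 1)`. -/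
lemma rpow_gap_sub_rpow_lt {m α u : ℝ} (hD0 : 0 < D) (hD : D < 1 / 2) (hm : 0 < m)
    (hu : 0 < u) (hu2 : m / gapConst D < α - u) :
    α ^ (2 * D) - (α - u) ^ (2 * D) < u * m ^ (2 * D - 1) := by
  have hK := gapConst_pos hD0
  have hmK : 0 < m / gapConst D := by positivity
  have hpos : 0 < α - u := hmK.trans hu2
  -- Mean value theorem; the intermediate age satisfies `c > α - u > m / K`, so the slope there is
  -- below `m^(2D-1)`.
  obtain ⟨c, ⟨hc1, hc2⟩, hc⟩ := exists_hasDerivAt_eq_slope (fun x : ℝ => x ^ (2 * D))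
    (fun x => 2 * D * x ^ (2 * D - 1)) (show α - u < α by linarith)
    (continuousOn_id.rpow_const fun x hx => Or.inr (by linarith))
    (fun x hx => Real.hasDerivAt_rpow_const (Or.inl (hpos.trans hx.1).ne'))
  have hcu : α - (α - u) = u := by ring
  rw [hcu, eq_div_iff hu.ne'] at hc
  rw [← hc, mul_comm u]
  gcongr
  have h1 : c ^ (2 * D - 1) < (m / gapConst D) ^ (2 * D - 1) :=
    Real.rpow_lt_rpow_of_neg hmK (hu2.trans hc1) (by linarith)
  have h2 : (m / gapConst D) ^ (2 * D - 1) = m ^ (2 * D - 1) * (1 / (2 * D)) := by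
    rw [Real.div_rpow hm.le hK.le, ← gapConst_rpow hD0 hD, div_eq_mul_inv, ← Real.rpow_neg hK.le,
      neg_sub]
  rw [h2] at h1
  calc 2 * D * c ^ (2 * D - 1) < 2 * D * (m ^ (2 * D - 1) * (1 / (2 * D))) := by gcongr
    _ = _ := by field_simp

/-- The left end of the search interval. -/
noncomputable def searchLeft (τ : ℤ → Ω → ℝ) (T : ℝ) (ω : Ω) : ℝ := timeSinceShock τ T ω / 2

/-- The right end of the search interval. -/
noncomputable def searchRight (D : ℝ) (τ : ℤ → Ω → ℝ) (T : ℝ) (ω : Ω) : ℝ :=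
  min T (timeSinceShock τ T ω + (lastGap τ T ω - timeSinceShock τ T ω / gapConst D) / 2)

namespace IsRegularConfig

/-- On the event, the margin `α - m / K` is positive. The right end uses only half of it, so that `t
- m` stays strictly below the margin throughout the interval. -/
lemma timeSinceShock_lt_searchRight (h : IsRegularConfig τ T ω) (hD0 : 0 < D)
    (hE : ω ∈ recentShock D τ T) : timeSinceShock τ T ω < searchRight D τ T ω := by
  apply lt_min (h.timeSinceShock_lt hE.1)
  have := (div_lt_iff₀' (gapConst_pos hD0)).2 hE.2
  linarith

/-- The limiting increment quotient has its strict maximum on the search interval at the last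
shock. -/
lemma quotient_lt (h : IsRegularConfig τ T ω) (hD0 : 0 < D) (hD : D < 1 / 2) (hσ : 0 < σ)
    (hT : 0 < T) (hE : ω ∈ recentShock D τ T)
    (ht : t ∈ Set.Icc (searchLeft τ T ω) (searchRight D τ T ω)) (hne : t ≠ timeSinceShock τ T ω) :
    (timeChange D σ τ T ω - timeChange D σ τ (T - t) ω) / t
      < (timeChange D σ τ T ω - timeChange D σ τ (T - timeSinceShock τ T ω) ω)
        / timeSinceShock τ T ω := by
  have hm := h.timeSinceShock_pos hT
  have hK := gapConst_pos hD0
  have hαK : timeSinceShock τ T ω / gapConst D < lastGap τ T ω := (div_lt_iff₀' hK).2 hE.2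
  have hmK : 0 < timeSinceShock τ T ω / gapConst D := by positivity
  have ht0 : 0 < t := by
    have := ht.1
    rw [searchLeft] at this
    linarith
  have hmax : (timeChange D σ τ T ω - timeChange D σ τ (T - timeSinceShock τ T ω) ω)
        / timeSinceShock τ T ω = σ ^ 2 * timeSinceShock τ T ω ^ (2 * D - 1) := by
    rw [h.timeChange_sub_of_le hT hm.le le_rfl, sub_self, Real.zero_rpow (by linarith), sub_zero,
      Real.rpow_sub_one hm.ne', mul_div_assoc]
  rw [hmax, div_lt_iff₀ ht0]
  rcases lt_or_gt_of_ne hne with hlt | hgt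
  · rw [h.timeChange_sub_of_le hT ht0.le hlt.le, mul_assoc]
    gcongr
    exact (rpow_sub_rpow_lt hD ht0 hlt).trans_eq (mul_comm _ _)
  · have ht2 : t ≤ timeSinceShock τ T ω
        + (lastGap τ T ω - timeSinceShock τ T ω / gapConst D) / 2 := ht.2.trans (min_le_right _ _)
    rw [h.timeChange_sub_of_lt hT hE.1 hgt (by linarith), mul_assoc]
    gcongr
    have h1 := rpow_gap_sub_rpow_lt (α := lastGap τ T ω) (u := t - timeSinceShock τ T ω) hD0 hD hm
      (by linarith) (by linarith)
    have h3 : timeSinceShock τ T ω ^ (2 * D)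
        = timeSinceShock τ T ω * timeSinceShock τ T ω ^ (2 * D - 1) := by
      rw [Real.rpow_sub_one hm.ne']
      field_simp
    nlinarith

end IsRegularConfig

end

/-! ### The discrete quotient near and away from the last shock. -/

section

variable {Ω : Type*} {τ : ℤ → Ω → ℝ} {W : ℝ≥0 → Ω → ℝ} {ω : Ω} {D σ T t : ℝ}

lemma discreteQuotient_eq (N : ℕ) : discreteQuotient D σ W τ T N t ω
    = (realizedVar (W · ω) (fun s => timeChange D σ τ s ω) N T
      - realizedVar (W · ω) (fun s => timeChange D σ τ s ω) N (T - t)) / t := by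
  simp only [discreteQuotient, Finset.sum_sub_distrib, realizedVar, logPrice]
  ring

lemma continuousOn_realizedVar {w : ℝ≥0 → ℝ} (hw : Continuous w) {J : ℝ → ℝ} {C p : ℝ}
    (hJ : IsHolderClock J (2 * T) C p) {N : ℕ} (hN : 1 ≤ N) :
    ContinuousOn (realizedVar w J N) (Set.Icc 0 T) := by
  have key : ∀ x : ℝ, 0 ≤ x → x ≤ N + 1 →
      ContinuousOn (fun S => w (J (x * S / N)).toNNReal) (Set.Icc 0 T) := fun x hx hx2 =>
    (hw.comp continuous_real_toNNReal).comp_continuousOn (hJ.continuousOn.comp (by fun_prop)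
      fun S hS => grid_mem_Icc hS hN hx hx2)
  refine continuousOn_finsetSum _ fun n hn => ?_
  have hn' : (n : ℝ) + 1 ≤ N + 1 := by exact_mod_cast Finset.mem_range.1 hn
  exact ((key _ (by positivity) hn').sub (key _ (by positivity) (by linarith))).pow 2

lemma searchLeft_pos (h : IsRegularConfig τ T ω) (hT : 0 < T) : 0 < searchLeft τ T ω :=
  half_pos (h.timeSinceShock_pos hT)

lemma searchLeft_lt (h : IsRegularConfig τ T ω) (hT : 0 < T) :
    searchLeft τ T ω < timeSinceShock τ T ω :=
  half_lt_self (h.timeSinceShock_pos hT)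

lemma searchRight_le : searchRight D τ T ω ≤ T := min_le_left _ _

lemma mapsTo_sub_searchInterval (h : IsRegularConfig τ T ω) (hT : 0 < T) :
    Set.MapsTo (fun t => T - t) (Set.Icc (searchLeft τ T ω) (searchRight D τ T ω))
      (Set.Icc 0 T) := fun t ht =>
  ⟨by linarith [ht.2, searchRight_le (D := D) (τ := τ) (T := T) (ω := ω)],
    by linarith [ht.1, searchLeft_pos h hT]⟩

lemma continuousOn_discreteQuotient (h : IsRegularConfig τ T ω) (hD0 : 0 < D) (hD : D < 1 / 2)
    (hσ : 0 < σ) (hT : 0 < T) (hw : Continuous (W · ω)) {N : ℕ} (hN : 1 ≤ N) :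
    ContinuousOn (fun t => discreteQuotient D σ W τ T N t ω)
      (Set.Icc (searchLeft τ T ω) (searchRight D τ T ω)) := by
  obtain ⟨C, hJ⟩ := h.isHolderClock hD0 hD hσ (show 0 ≤ 2 * T by linarith)
  simp_rw [discreteQuotient_eq]
  refine ContinuousOn.div (continuousOn_const.sub ?_) continuousOn_id fun t ht =>
    ((searchLeft_pos h hT).trans_le ht.1).ne'
  exact (continuousOn_realizedVar hw hJ hN).comp (by fun_prop) (mapsTo_sub_searchInterval h hT)

/-- The rational points, moved into the search interval. -/
noncomputable def searchPoint (D : ℝ) (τ : ℤ → Ω → ℝ) (T s : ℝ) (ω : Ω) : ℝ :=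
  max (searchLeft τ T ω) (min (searchRight D τ T ω) s)

lemma searchPoint_mem (h : IsRegularConfig τ T ω) (hD0 : 0 < D) (hT : 0 < T)
    (hE : ω ∈ recentShock D τ T) (s : ℝ) :
    searchPoint D τ T s ω ∈ Set.Icc (searchLeft τ T ω) (searchRight D τ T ω) :=
  ⟨le_max_left _ _, max_le ((searchLeft_lt h hT).trans
    (h.timeSinceShock_lt_searchRight hD0 hE)).le (min_le_left _ _)⟩

lemma searchPoint_of_mem {s : ℝ}
    (hs : s ∈ Set.Icc (searchLeft τ T ω) (searchRight D τ T ω)) :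
    searchPoint D τ T s ω = s := by
  rw [searchPoint, min_eq_right hs.2, max_eq_right hs.1]

lemma continuous_searchPoint : Continuous fun s => searchPoint D τ T s ω := by
  unfold searchPoint
  fun_prop

/-- The event that `Q_T^{(N)}` comes, at points further than `ε / 2` from the last shock, arbitrarily
close to its value at the last shock, or exceeds it. -/
def farNearMax (D σ : ℝ) (W : ℝ≥0 → Ω → ℝ) (τ : ℤ → Ω → ℝ) (T ε : ℝ) (N : ℕ) : Set Ω :=
  {ω | ∀ k : ℕ, ∃ s : ℚ, ε / 2 < |searchPoint D τ T s ω - timeSinceShock τ T ω| ∧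
    discreteQuotient D σ W τ T N (timeSinceShock τ T ω) ω - 1 / ((k : ℝ) + 1)
      < discreteQuotient D σ W τ T N (searchPoint D τ T s ω) ω}

/-- By compactness, `q` is below `q m` by a fixed gap `g` at distance at least `ε / 2` from `m`.
Once the discrete quotient is within `g / 3` of `q`, a slack `1 / (k + 1) < g / 3` is too small for
membership. -/
lemma eventually_notMem_farNearMax (h : IsRegularConfig τ T ω) (hD0 : 0 < D) (hD : D < 1 / 2)
    (hσ : 0 < σ) (hT : 0 < T) (hE : ω ∈ recentShock D τ T)
    (hconv : ∀ ε > 0, ∀ᶠ N : ℕ in atTop, ∀ S ∈ Set.Icc 0 T,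
      |realizedVar (W · ω) (fun s => timeChange D σ τ s ω) N S - timeChange D σ τ S ω| ≤ ε)
    {ε : ℝ} (hε : 0 < ε) :
    ∀ᶠ N : ℕ in atTop, ω ∉ farNearMax D σ W τ T ε N := by
  obtain ⟨C, hJ⟩ := h.isHolderClock hD0 hD hσ (show 0 ≤ 2 * T by linarith)
  have ha := searchLeft_pos h hT
  have ham := searchLeft_lt h hT
  have hmb := h.timeSinceShock_lt_searchRight hD0 hE
  set a := searchLeft τ T ω
  set b := searchRight D τ T ω
  set m := timeSinceShock τ T ω
  set J := fun s => timeChange D σ τ s ω with hJdef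
  set q : ℝ → ℝ := fun t => (J T - J (T - t)) / t with hq
  have hqc : ContinuousOn q (Set.Icc a b) := by
    refine ContinuousOn.div (continuousOn_const.sub ?_) continuousOn_id fun t ht =>
      (ha.trans_le ht.1).ne'
    exact hJ.continuousOn.comp (by fun_prop) fun t ht =>
      Set.Icc_subset_Icc_right (by linarith) (mapsTo_sub_searchInterval h hT ht)
  have hK : IsCompact (Set.Icc a b ∩ {t | ε / 2 ≤ |t - m|}) :=
    isCompact_Icc.inter_right (isClosed_le continuous_const (by fun_prop))
  obtain ⟨g, hg, hgap⟩ : ∃ g > 0, ∀ t ∈ Set.Icc a b ∩ {t | ε / 2 ≤ |t - m|}, q t ≤ q m - g := by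
    rcases (Set.Icc a b ∩ {t | ε / 2 ≤ |t - m|}).eq_empty_or_nonempty with h0 | h0
    · exact ⟨1, one_pos, fun t ht => by simp [h0] at ht⟩
    · obtain ⟨t0, ht0, hmax⟩ := hK.exists_isMaxOn h0 (hqc.mono Set.inter_subset_left)
      have hne : t0 ≠ m := by
        rintro rfl
        have := ht0.2
        simp only [Set.mem_ofPred_eq, sub_self, abs_zero] at this
        linarith
      have hlt : q t0 < q m := h.quotient_lt hD0 hD hσ hT hE ht0.1 hne
      refine ⟨q m - q t0, by linarith, fun t ht => ?_⟩
      have h4 : q t ≤ q t0 := hmax ht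
      linarith
  obtain ⟨k, hk⟩ := exists_nat_one_div_lt (show 0 < g / 3 by linarith)
  -- Two realized variations enter each quotient and the division is by `t ≥ a`, so the quotient
  -- error is at most `g / 3`.
  filter_upwards [hconv (a * g / 6) (by positivity)] with N hN hmem
  obtain ⟨s, hs1, hs2⟩ := hmem k
  have hQ : ∀ t ∈ Set.Icc a b, |discreteQuotient D σ W τ T N t ω - q t| ≤ g / 3 := by
    intro t ht
    have ht0 : 0 < t := ha.trans_le ht.1
    have h1 := abs_le.1 (hN T ⟨hT.le, le_rfl⟩)
    have h2 := abs_le.1 (hN (T - t) (mapsTo_sub_searchInterval h hT ht))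
    rw [discreteQuotient_eq, hq, ← sub_div, abs_div, abs_of_pos ht0, div_le_iff₀ ht0]
    have h3 : a * g / 3 ≤ g / 3 * t := by nlinarith [ht.1]
    rw [abs_le]
    constructor <;> linarith
  have hpt : searchPoint D τ T s ω ∈ Set.Icc a b := searchPoint_mem h hD0 hT hE s
  have h1 := abs_le.1 (hQ _ hpt)
  have h2 := abs_le.1 (hQ m ⟨ham.le, hmb.le⟩)
  have h3 := hgap _ ⟨hpt, hs1.le⟩
  linarith

/-- Halving `ε` and the slack `1 / (k + 1)` make both conditions strict at the maximum point. By
continuity they are open, so a rational point satisfies them too. -/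
lemma mem_farNearMax_of_isMaxOn (h : IsRegularConfig τ T ω) (hD0 : 0 < D) (hD : D < 1 / 2)
    (hσ : 0 < σ) (hT : 0 < T) (hE : ω ∈ recentShock D τ T) (hw : Continuous (W · ω))
    {N : ℕ} (hN : 1 ≤ N) {μ ε : ℝ} (hε : 0 < ε)
    (hμ : μ ∈ Set.Icc (searchLeft τ T ω) (searchRight D τ T ω))
    (hmax : IsMaxOn (fun t => discreteQuotient D σ W τ T N t ω)
      (Set.Icc (searchLeft τ T ω) (searchRight D τ T ω)) μ)
    (hfar : ε ≤ |μ - timeSinceShock τ T ω|) : ω ∈ farNearMax D σ W τ T ε N := by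
  intro k
  have hcont : Continuous fun s => discreteQuotient D σ W τ T N (searchPoint D τ T s ω) ω :=
    (continuousOn_discreteQuotient h hD0 hD hσ hT hw hN).comp_continuous continuous_searchPoint
      (searchPoint_mem h hD0 hT hE)
  have hopen : IsOpen {s : ℝ | ε / 2 < |searchPoint D τ T s ω - timeSinceShock τ T ω| ∧
      discreteQuotient D σ W τ T N (timeSinceShock τ T ω) ω - 1 / ((k : ℝ) + 1)
      < discreteQuotient D σ W τ T N (searchPoint D τ T s ω) ω} :=
    (isOpen_lt continuous_const (continuous_searchPoint.sub continuous_const).abs).inter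
      (isOpen_lt continuous_const hcont)
  refine Rat.denseRange_cast.exists_mem_open hopen ⟨μ, ?_⟩
  simp only [Set.mem_ofPred_eq, searchPoint_of_mem hμ]
  refine ⟨by linarith, ?_⟩
  have h1 : discreteQuotient D σ W τ T N (timeSinceShock τ T ω) ω
      ≤ discreteQuotient D σ W τ T N μ ω :=
    hmax ⟨(searchLeft_lt h hT).le, (h.timeSinceShock_lt_searchRight hD0 hE).le⟩
  have h2 : 0 < 1 / ((k : ℝ) + 1) := by positivity
  linarith

end

/-! ### Measurability of the clock, the quotient and a maximum point. -/

section

section Measurability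

variable {Ω : Type*} {mΩ : MeasurableSpace Ω} {τ : ℤ → Ω → ℝ} {W : ℝ≥0 → Ω → ℝ} {t : Ω → ℝ}

lemma measurable_apply_index {F : ℕ → Ω → ℝ} (hF : ∀ n, Measurable (F n)) {i : Ω → ℕ}
    (hi : Measurable i) : Measurable fun ω => F (i ω) ω :=
  (measurable_from_prod_countable_right (f := fun p : ℕ × Ω => F p.1 p.2) hF).comp
    (hi.prodMk measurable_id)

lemma measurable_shockIndex (hτ : ∀ n, Measurable (τ n)) (ht : Measurable t) :
    Measurable fun ω => shockIndex τ (t ω) ω := by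
  have hle : ∀ n : ℕ, MeasurableSet {ω | τ n ω ≤ t ω} := fun n => measurableSet_le (hτ n) ht
  -- For arbitrary configurations, `sSup` of an empty or unbounded set is `0`. Nonzero levels are
  -- therefore genuine maxima, and level `0` is treated as the complement of the others.
  have hpos : ∀ k : ℕ, k ≠ 0 → {ω | shockIndex τ (t ω) ω = k}
      = {ω | τ k ω ≤ t ω} ∩ ⋂ j ∈ Set.Ioi k, {ω | τ (j : ℕ) ω ≤ t ω}ᶜ := by
    intro k hk
    ext ω
    simp only [Set.mem_ofPred_eq, Set.mem_inter_iff, Set.mem_iInter, Set.mem_Ioi,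
      Set.mem_compl_iff]
    constructor
    · intro h
      have hne : {n : ℕ | τ (n : ℤ) ω ≤ t ω}.Nonempty := by
        by_contra h0
        rw [Set.not_nonempty_iff_eq_empty] at h0
        rw [shockIndex, h0, csSup_empty] at h
        exact hk h.symm
      have hbdd : BddAbove {n : ℕ | τ (n : ℤ) ω ≤ t ω} := by
        by_contra h0
        rw [shockIndex, Nat.sSup_of_not_bddAbove h0] at h
        exact hk h.symm
      have hmem := Nat.sSup_mem hne hbdd
      rw [shockIndex] at h
      rw [h] at hmem
      refine ⟨hmem, fun j hj hj2 => ?_⟩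
      have := le_csSup hbdd (show j ∈ {n : ℕ | τ (n : ℤ) ω ≤ t ω} from hj2)
      omega
    · rintro ⟨h1, h2⟩
      refine IsGreatest.csSup_eq ⟨h1, fun j hj => ?_⟩
      by_contra hlt
      exact h2 j (not_le.1 hlt) hj
  have hmeas : ∀ k : ℕ, k ≠ 0 → MeasurableSet {ω | shockIndex τ (t ω) ω = k} := fun k hk => by
    rw [hpos k hk]
    exact (hle k).inter (MeasurableSet.biInter (Set.to_countable _) fun j _ => (hle j).compl)
  refine measurable_to_countable' fun k => ?_
  rcases eq_or_ne k 0 with rfl | hk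
  · have : (fun ω => shockIndex τ (t ω) ω) ⁻¹' {0}
        = (⋃ k ∈ {k : ℕ | k ≠ 0}, {ω | shockIndex τ (t ω) ω = k})ᶜ := by
      ext ω
      simp only [Set.mem_preimage, Set.mem_singleton_iff, Set.mem_compl_iff, Set.mem_iUnion,
        Set.mem_ofPred_eq, exists_prop, not_exists, not_and]
      grind
    rw [this]
    exact (MeasurableSet.biUnion (Set.to_countable _) fun k hk => hmeas k hk).compl
  · exact hmeas k hk

lemma measurable_timeChange (D σ : ℝ) (hτ : ∀ n, Measurable (τ n)) (ht : Measurable t) :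
    Measurable fun ω => timeChange D σ τ (t ω) ω := by
  have hi := measurable_shockIndex hτ ht
  have h1 : Measurable fun ω => τ (shockIndex τ (t ω) ω) ω :=
    measurable_apply_index (F := fun n => τ n) (fun n => hτ n) hi
  have h2 := measurable_apply_index (F := fun i ω => ∑ k ∈ Finset.Icc 1 i,
      (τ (k : ℤ) ω - τ ((k : ℤ) - 1) ω) ^ (2 * D)) (fun i => Finset.measurable_fun_sum _ fun k _ =>
        ((hτ _).sub (hτ _)).pow_const _) hi
  exact ((((ht.sub h1).pow_const _).add h2).sub ((hτ 0).neg.pow_const _)).const_mul _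

lemma measurable_timeSinceShock (hτ : ∀ n, Measurable (τ n)) (T : ℝ) :
    Measurable (timeSinceShock τ T) :=
  measurable_const.sub (measurable_apply_index (F := fun n => τ n) (fun n => hτ n)
    (measurable_shockIndex hτ measurable_const))

lemma measurable_lastGap (hτ : ∀ n, Measurable (τ n)) (T : ℝ) : Measurable (lastGap τ T) :=
  measurable_apply_index (F := fun n ω => τ n ω - τ ((n : ℤ) - 1) ω)
    (fun _ => (hτ _).sub (hτ _)) (measurable_shockIndex hτ measurable_const)

lemma measurableSet_recentShock (hτ : ∀ n, Measurable (τ n)) (D T : ℝ) :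
    MeasurableSet (recentShock D τ T) :=
  (measurableSet_le measurable_const (measurable_shockIndex hτ measurable_const)).inter
    (measurableSet_lt (measurable_timeSinceShock hτ T) ((measurable_lastGap hτ T).const_mul _))

lemma measurable_searchLeft (hτ : ∀ n, Measurable (τ n)) (T : ℝ) : Measurable (searchLeft τ T) :=
  (measurable_timeSinceShock hτ T).div_const _

lemma measurable_searchRight (hτ : ∀ n, Measurable (τ n)) (D T : ℝ) :
    Measurable (searchRight D τ T) :=
  measurable_const.min ((measurable_timeSinceShock hτ T).add
    (((measurable_lastGap hτ T).sub ((measurable_timeSinceShock hτ T).div_const _)).div_const _))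

lemma measurable_searchPoint (hτ : ∀ n, Measurable (τ n)) (D T s : ℝ) :
    Measurable (searchPoint D τ T s) :=
  (measurable_searchLeft hτ T).max ((measurable_searchRight hτ D T).min measurable_const)

lemma measurable_discreteQuotient (D σ T : ℝ) (hτ : ∀ n, Measurable (τ n))
    (hW : Measurable fun p : ℝ≥0 × Ω => W p.1 p.2) (ht : Measurable t) (N : ℕ) :
    Measurable fun ω => discreteQuotient D σ W τ T N (t ω) ω := by
  have key : ∀ {s : Ω → ℝ}, Measurable s → Measurable fun ω => logPrice D σ W τ (s ω) ω :=
    fun hs => hW.comp ((measurable_timeChange D σ hτ hs).real_toNNReal.prodMk measurable_id)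
  refine (measurable_const.div ht).mul (Finset.measurable_fun_sum _ fun n _ => ?_)
  exact (((key measurable_const).sub (key measurable_const)).pow_const 2).sub
    (((key (by fun_prop)).sub (key (by fun_prop))).pow_const 2)

lemma measurableSet_farNearMax (D σ T ε : ℝ) (hτ : ∀ n, Measurable (τ n))
    (hW : Measurable fun p : ℝ≥0 × Ω => W p.1 p.2) (N : ℕ) :
    MeasurableSet (farNearMax D σ W τ T ε N) := by
  have hm := measurable_timeSinceShock hτ T
  simp only [farNearMax, Set.ofPred_forall, Set.ofPred_exists]
  refine MeasurableSet.iInter fun k => MeasurableSet.iUnion fun s => ?_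
  have hs := measurable_searchPoint hτ D T s
  exact (measurableSet_lt measurable_const (hs.sub hm).abs).inter
    (measurableSet_lt ((measurable_discreteQuotient D σ T hτ hW hm N).sub measurable_const)
      (measurable_discreteQuotient D σ T hτ hW hs N))

end Measurability

/-- A version of evaluation of paths that is jointly measurable for the product `σ`-algebra. -/
noncomputable def evalLimsup (u : ℝ≥0) (w : ℝ≥0 → ℝ) : ℝ :=
  limsup (fun k : ℕ => w ((⌊u * k⌋₊ : ℝ≥0) / k)) atTop

/-- For fixed `k`, the sampled time takes countably many values, so only countably many coordinates
of the path are used; a countable limsup preserves this. -/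
lemma measurable_evalLimsup : Measurable fun p : ℝ≥0 × (ℝ≥0 → ℝ) => evalLimsup p.1 p.2 := by
  refine Measurable.limsup fun k => ?_
  have h1 : Measurable fun q : ℕ × (ℝ≥0 → ℝ) => q.2 ((q.1 : ℝ≥0) / k) :=
    measurable_from_prod_countable_right fun n =>
      (measurable_pi_apply ((n : ℝ≥0) / k) : Measurable fun w : ℝ≥0 → ℝ => w ((n : ℝ≥0) / k))
  have h2 : Measurable fun p : ℝ≥0 × (ℝ≥0 → ℝ) => ⌊p.1 * (k : ℝ≥0)⌋₊ :=
    Nat.measurable_floor.comp (measurable_fst.mul_const _)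
  exact h1.comp (h2.prodMk measurable_snd)

lemma evalLimsup_of_continuous {w : ℝ≥0 → ℝ} (hw : Continuous w) (u : ℝ≥0) :
    evalLimsup u w = w u := by
  refine Tendsto.limsup_eq ((hw.tendsto u).comp ?_)
  have h1 := (tendsto_nat_floor_mul_div_atTop (R := ℝ) (a := u) u.2).comp
    tendsto_natCast_atTop_atTop
  rw [← NNReal.tendsto_coe]
  refine h1.congr fun n => ?_
  simp only [Function.comp, NNReal.coe_div, NNReal.coe_natCast]
  congr 2

attribute [irreducible] evalLimsup

/-- The leftmost maximum point on `[0, 1]` of a continuous random function is measurable. -/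
lemma exists_measurable_isMaxOn {Ω : Type*} {mΩ : MeasurableSpace Ω} {f : ℝ → Ω → ℝ}
    (hf : ∀ s, Measurable (f s)) (hc : ∀ ω, Continuous (f · ω)) :
    ∃ μ : Ω → ℝ, Measurable μ ∧
      ∀ ω, μ ω ∈ Set.Icc (0 : ℝ) 1 ∧ IsMaxOn (f · ω) (Set.Icc 0 1) (μ ω) := by
  set S : Ω → Set ℝ := fun ω => {c ∈ Set.Icc (0 : ℝ) 1 | ∀ s ∈ Set.Icc (0 : ℝ) 1, f s ω ≤ f c ω}
    with hS
  have hSne : ∀ ω, (S ω).Nonempty := fun ω => by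
    obtain ⟨c, hc1, hc2⟩ := isCompact_Icc.exists_isMaxOn (Set.nonempty_Icc.2 zero_le_one)
      (hc ω).continuousOn
    exact ⟨c, hc1, fun s hs => hc2 hs⟩
  have hSclosed : ∀ ω, IsClosed (S ω) := fun ω => by
    have : S ω = Set.Icc (0 : ℝ) 1 ∩ ⋂ s ∈ Set.Icc (0 : ℝ) 1, {c | f s ω ≤ f c ω} := by
      ext c
      simp [hS]
    rw [this]
    exact isClosed_Icc.inter (isClosed_biInter fun s _ => isClosed_le continuous_const (hc ω))
  have hSbdd : ∀ ω, BddBelow (S ω) := fun ω => ⟨0, fun c hc => hc.1.1⟩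
  have hmem : ∀ ω, sInf (S ω) ∈ S ω := fun ω => (hSclosed ω).csInf_mem (hSne ω) (hSbdd ω)
  refine ⟨fun ω => sInf (S ω), ?_, fun ω => ⟨(hmem ω).1, fun s hs => (hmem ω).2 s hs⟩⟩
  -- The leftmost maximum point is at most `c` exactly when the maximum over `[0, c]` equals that
  -- over `[0, 1]`; by continuity this is tested on clamped rationals with slack.
  have hclamp : ∀ c ∈ Set.Icc (0 : ℝ) 1, {ω | sInf (S ω) ≤ c} = ⋂ s : ℚ, ⋂ k : ℕ, ⋃ s' : ℚ,
      {ω | f (max 0 (min 1 (s : ℝ))) ω - 1 / ((k : ℝ) + 1) < f (max 0 (min c (s' : ℝ))) ω} := by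
    intro c hc01
    ext ω
    simp only [Set.mem_ofPred_eq, Set.mem_iInter, Set.mem_iUnion]
    have hcl : ∀ e : ℝ, Continuous fun s : ℝ => f (max 0 (min e s)) ω := fun e =>
      (hc ω).comp (by fun_prop)
    constructor
    · intro hle s k
      have h1 := (hmem ω).2 (max 0 (min 1 (s : ℝ)))
        ⟨le_max_left _ _, max_le zero_le_one (min_le_left _ _)⟩
      refine Rat.denseRange_cast.exists_mem_open (s := {x : ℝ | f (max 0 (min 1 (s : ℝ))) ω
        - 1 / ((k : ℝ) + 1) < f (max 0 (min c x)) ω})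
        (isOpen_lt continuous_const (hcl c)) ⟨sInf (S ω), ?_⟩
      simp only [Set.mem_ofPred_eq]
      rw [min_eq_right hle, max_eq_right (hmem ω).1.1]
      have : 0 < 1 / ((k : ℝ) + 1) := by positivity
      linarith
    · intro h
      obtain ⟨y, hy, hymax⟩ := isCompact_Icc.exists_isMaxOn (Set.nonempty_Icc.2 hc01.1)
        (hc ω).continuousOn (s := Set.Icc 0 c)
      have hrat : ∀ s : ℚ, f (max 0 (min 1 (s : ℝ))) ω ≤ f y ω := by
        intro s
        by_contra hlt
        obtain ⟨k, hk⟩ := exists_nat_one_div_lt (sub_pos.2 (not_le.1 hlt))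
        obtain ⟨s', hs'⟩ := h s k
        have h2 : f (max 0 (min c (s' : ℝ))) ω ≤ f y ω :=
          hymax ⟨le_max_left _ _, max_le hc01.1 (min_le_left _ _)⟩
        linarith
      have hall : ∀ s : ℝ, f (max 0 (min 1 s)) ω ≤ f y ω := fun s =>
        Rat.denseRange_cast.induction_on s (isClosed_le (hcl 1) continuous_const) hrat
      refine (csInf_le (hSbdd ω) ⟨⟨hy.1, hy.2.trans hc01.2⟩, fun s hs => ?_⟩).trans hy.2
      have := hall s
      rwa [min_eq_right hs.2, max_eq_right hs.1] at this
  refine measurable_of_Iic fun c => ?_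
  change MeasurableSet {ω | sInf (S ω) ≤ c}
  rcases lt_or_ge c 0 with h0 | h0
  · have : {ω | sInf (S ω) ≤ c} = ∅ := by
      ext ω
      simp only [Set.mem_ofPred_eq, Set.mem_empty_iff_false, iff_false, not_le]
      exact h0.trans_le (hmem ω).1.1
    rw [this]
    exact MeasurableSet.empty
  rcases le_or_gt c 1 with h1 | h1
  · rw [hclamp c ⟨h0, h1⟩]
    exact MeasurableSet.iInter fun s => MeasurableSet.iInter fun k => MeasurableSet.iUnion fun s' =>
      measurableSet_lt ((hf _).sub measurable_const) (hf _)
  · have : {ω | sInf (S ω) ≤ c} = Set.univ := by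
      ext ω
      simp only [Set.mem_ofPred_eq, Set.mem_univ, iff_true]
      exact (hmem ω).1.2.trans h1.le
    rw [this]
    exact MeasurableSet.univ

end

/-! ### Conditioning on the shocks and convergence of the maximum points. -/

section

/-- The quotient sees only the shock configuration and the path, which allows passing between `W`
and its jointly measurable version. -/
lemma discreteQuotient_congr {Ω Ω' : Type*} {τ : ℤ → Ω → ℝ} {W : ℝ≥0 → Ω → ℝ} {ω : Ω}
    {τ' : ℤ → Ω' → ℝ} {W' : ℝ≥0 → Ω' → ℝ} {ω' : Ω'} (hτ : ∀ n, τ n ω = τ' n ω')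
    (hW : ∀ u, W u ω = W' u ω') (D σ T t : ℝ) (N : ℕ) :
    discreteQuotient D σ W τ T N t ω = discreteQuotient D σ W' τ' T N t ω' := by
  simp only [discreteQuotient, logPrice, timeChange, shockIndex, hτ, hW]

variable {Ω : Type*} [MeasurableSpace Ω] {P : Measure Ω}
  {W : ℝ≥0 → Ω → ℝ} {τ : ℤ → Ω → ℝ} {D lam σ T : ℝ}

lemma IsPoissonPointProcess.ae_forall_ne (hτ : IsPoissonPointProcess lam τ P) (T : ℝ) :
    ∀ᵐ ω ∂P, ∀ n, τ n ω ≠ T := by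
  have hl := hτ.hasLaw_count {T} (measurableSet_singleton T) Bornology.isBounded_singleton
  have hvol : volume.real ({T} : Set ℝ) = 0 := by simp [measureReal_def]
  rw [hvol, mul_zero, Real.toNNReal_zero] at hl
  have h0 : ∀ᵐ k ∂(poissonMeasure 0), k = 0 := by
    exact (prob_compl_eq_zero_iff (measurableSet_singleton 0)).2
      ((poissonMeasure_singleton 0 0).trans (by simp))
  have h1 := (hl.ae_iff (p := fun k => k = 0) (measurable_of_countable _)).2 h0
  filter_upwards [h1, hτ.strictMono] with ω hω hmono n hn
  -- Finiteness is needed because `Set.ncard` is also `0` on infinite sets.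
  have hsub : {n : ℤ | τ n ω ∈ ({T} : Set ℝ)}.Subsingleton := fun i hi j hj =>
    hmono.injective ((show τ i ω = T from hi).trans (show τ j ω = T from hj).symm)
  have h2 := (Set.ncard_eq_zero hsub.finite).1 hω
  have h3 : n ∈ {n : ℤ | τ n ω ∈ ({T} : Set ℝ)} := hn
  rw [h2] at h3
  exact h3

lemma IsPoissonPointProcess.ae_isRegularConfig (hτ : IsPoissonPointProcess lam τ P) (T : ℝ) :
    ∀ᵐ ω ∂P, IsRegularConfig τ T ω := by
  filter_upwards [hτ.strictMono, hτ.tendsto_atTop, hτ.labelling, hτ.ae_forall_ne T]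
    with ω h1 h2 h3 h4
  exact ⟨h1, h2, h3.1, h3.2, h4⟩

lemma measurable_evalLimsup_path (hWm : ∀ t, Measurable (W t)) :
    Measurable fun p : ℝ≥0 × Ω => evalLimsup p.1 (W · p.2) := by
  have h1 : Measurable fun ω t => W t ω := measurable_pi_lambda _ hWm
  have h2 : Measurable fun p : ℝ≥0 × Ω => (p.1, fun t => W t p.2) :=
    measurable_fst.prodMk (h1.comp measurable_snd)
  exact measurable_evalLimsup.comp h2

/-- Measurable maximum points of the difference quotient on the search interval. -/
lemma exists_measurable_areMaxPoints (hD0 : 0 < D) (hD : D < 1 / 2) (hσ : 0 < σ) (hT : 0 < T)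
    (hWm : ∀ t, Measurable (W t)) (hW : IsBrownianReal W P)
    (hτ : IsPoissonPointProcess lam τ P) :
    ∃ μ : ℕ → Ω → ℝ, (∀ N, Measurable (μ N)) ∧
      AreMaxPoints P (recentShock D τ T) (discreteQuotient D σ W τ T) (searchLeft τ T)
        (searchRight D τ T) μ := by
  have hgood : ∀ᵐ ω ∂P, IsRegularConfig τ T ω ∧ Continuous (W · ω) :=
    (hτ.ae_isRegularConfig T).and hW.cont
  -- The exceptional set need not be measurable, so it is enlarged to a measurable null set.
  obtain ⟨B, hBsub, hBm, hB0⟩ := exists_measurable_superset_of_null (ae_iff.1 hgood)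
  have hG : ∀ ω, ω ∉ B → IsRegularConfig τ T ω ∧ Continuous (W · ω) := fun ω hω =>
    not_not.1 fun h => hω (hBsub h)
  have ham := measurable_searchLeft hτ.measurable T
  have hbm := measurable_searchRight hτ.measurable D T
  have key : ∀ N : ℕ, ∃ μ : Ω → ℝ, Measurable μ ∧ (1 ≤ N → ∀ᵐ ω ∂P, ω ∈ recentShock D τ T →
      μ ω ∈ Set.Icc (searchLeft τ T ω) (searchRight D τ T ω) ∧
        IsMaxOn (fun t => discreteQuotient D σ W τ T N t ω)
          (Set.Icc (searchLeft τ T ω) (searchRight D τ T ω)) (μ ω)) := by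
    intro N
    rcases Nat.lt_or_ge N 1 with hN | hN
    · exact ⟨fun _ => 0, measurable_const, fun h => absurd h (by omega)⟩
    set pt : ℝ → Ω → ℝ := fun s ω =>
      searchPoint D τ T (searchLeft τ T ω + s * (searchRight D τ T ω - searchLeft τ T ω)) ω with hpt
    -- The search interval is rescaled to `[0, 1]`, and the function is set to `0` off the good
    -- event so that continuity holds for every `ω`.
    set f : ℝ → Ω → ℝ := fun s => (Bᶜ ∩ recentShock D τ T).indicator fun ω =>
      discreteQuotient D σ (fun u ω => evalLimsup u (W · ω)) τ T N (pt s ω) ω with hf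
    have hptm : ∀ s, Measurable (pt s) := fun s =>
      ham.max (hbm.min (ham.add ((hbm.sub ham).const_mul s)))
    have hfm : ∀ s, Measurable (f s) := fun s =>
      (measurable_discreteQuotient D σ T hτ.measurable (measurable_evalLimsup_path hWm)
        (hptm s) N).indicator (hBm.compl.inter (measurableSet_recentShock hτ.measurable D T))
    have hfeq : ∀ ω ∈ Bᶜ ∩ recentShock D τ T, ∀ s,
        f s ω = discreteQuotient D σ W τ T N (pt s ω) ω := by
      intro ω hω s
      simp only [hf, Set.indicator_of_mem hω]
      exact discreteQuotient_congr (fun _ => rfl)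
        (fun u => evalLimsup_of_continuous (hG ω hω.1).2 u) _ _ _ _ _
    have hfc : ∀ ω, Continuous (f · ω) := by
      intro ω
      by_cases hω : ω ∈ Bᶜ ∩ recentShock D τ T
      · simp_rw [hfeq ω hω]
        obtain ⟨hreg, hc⟩ := hG ω hω.1
        refine (continuousOn_discreteQuotient hreg hD0 hD hσ hT hc hN).comp_continuous
          (continuous_searchPoint.comp (by fun_prop)) fun s => searchPoint_mem hreg hD0 hT hω.2 _
      · simp only [hf, Set.indicator_of_notMem hω]
        exact continuous_const
    obtain ⟨ν, hνm, hν⟩ := exists_measurable_isMaxOn hfm hfc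
    refine ⟨fun ω => pt (ν ω) ω, ham.max (hbm.min (ham.add (hνm.mul (hbm.sub ham)))), fun _ => ?_⟩
    have hBae : ∀ᵐ ω ∂P, ω ∉ B := measure_eq_zero_iff_ae_notMem.1 hB0
    filter_upwards [hBae] with ω hωB hE
    have hω : ω ∈ Bᶜ ∩ recentShock D τ T := ⟨hωB, hE⟩
    obtain ⟨hreg, hc⟩ := hG ω hωB
    refine ⟨searchPoint_mem hreg hD0 hT hE _, fun t ht => ?_⟩
    have hab : 0 < searchRight D τ T ω - searchLeft τ T ω := by
      have := searchLeft_lt hreg hT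
      have := hreg.timeSinceShock_lt_searchRight hD0 hE
      linarith
    have h1 := (hν ω).2 (show (t - searchLeft τ T ω) / (searchRight D τ T ω - searchLeft τ T ω)
      ∈ Set.Icc (0 : ℝ) 1 from ⟨div_nonneg (by linarith [ht.1]) hab.le,
        (div_le_one hab).2 (by linarith [ht.2])⟩)
    simp only [Set.mem_ofPred_eq, hfeq ω hω] at h1
    have h2 : pt ((t - searchLeft τ T ω) / (searchRight D τ T ω - searchLeft τ T ω)) ω = t := by
      simp only [hpt]
      rw [div_mul_cancel₀ _ hab.ne', add_sub_cancel, searchPoint_of_mem ht]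
    rw [h2] at h1
    exact h1
  choose μ hμ1 hμ2 using key
  exact ⟨μ, hμ1, hμ2⟩

variable [IsProbabilityMeasure P]

/-- If the shocks are independent of the Brownian motion, almost surely on `recentShock` the
difference quotient eventually stays away from its maximum outside a neighbourhood of the last
shock. The paths are evaluated in a jointly measurable way. -/
lemma ae_eventually_notMem_farNearMax (hD0 : 0 < D) (hD : D < 1 / 2) (hσ : 0 < σ) (hT : 0 < T)
    (hWm : ∀ t, Measurable (W t)) (hW : IsBrownianReal W P)
    (hτ : IsPoissonPointProcess lam τ P)
    (hWτ : IndepFun (fun ω t => W t ω) (fun ω n => τ n ω) P) {ε : ℝ} (hε : 0 < ε) :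
    ∀ᵐ ω ∂P, ω ∈ recentShock D τ T → ∀ᶠ N : ℕ in atTop,
      ω ∉ farNearMax D σ (fun u ω => evalLimsup u (W · ω)) τ T ε N := by
  -- The model is transported to the space of pairs (shocks, path), where the joint law is a
  -- product.
  set τ' : ℤ → (ℤ → ℝ) × (ℝ≥0 → ℝ) → ℝ := fun n p => p.1 n with hτ'
  set W' : ℝ≥0 → (ℤ → ℝ) × (ℝ≥0 → ℝ) → ℝ := fun u p => evalLimsup u p.2 with hW'
  have hτ'm : ∀ n, Measurable (τ' n) := fun n => (measurable_pi_apply n).comp measurable_fst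
  have hpm : Measurable fun p : ℝ≥0 × ((ℤ → ℝ) × (ℝ≥0 → ℝ)) => (p.1, p.2.2) :=
    measurable_fst.prodMk (measurable_snd.comp measurable_snd)
  have hW'm : Measurable fun p : ℝ≥0 × ((ℤ → ℝ) × (ℝ≥0 → ℝ)) => W' p.1 p.2 :=
    measurable_evalLimsup.comp hpm
  have hWpath : Measurable fun ω t => W t ω := measurable_pi_lambda _ hWm
  have hτpath : Measurable fun ω n => τ n ω := measurable_pi_lambda _ hτ.measurable
  set B : Set ((ℤ → ℝ) × (ℝ≥0 → ℝ)) :=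
    recentShock D τ' T ∩ {p | ∀ N₀ : ℕ, ∃ N : ℕ, N₀ ≤ N ∧ p ∈ farNearMax D σ W' τ' T ε N} with hB
  have hBm : MeasurableSet B := by
    refine (measurableSet_recentShock hτ'm D T).inter ?_
    simp only [Set.ofPred_forall, Set.ofPred_exists]
    refine MeasurableSet.iInter fun N₀ => MeasurableSet.iUnion fun N => ?_
    exact (MeasurableSet.const _).inter (measurableSet_farNearMax D σ T ε hτ'm hW'm N)
  -- With the shocks frozen at `ω₀`, the clock is deterministic and uniform convergence of the
  -- realized variation applies; Fubini then recombines the null sections.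
  have hsec : ∀ᵐ ω₀ ∂P, P.map (fun ω t => W t ω) (Prod.mk (fun n => τ n ω₀) ⁻¹' B) = 0 := by
    filter_upwards [hτ.ae_isRegularConfig T] with ω₀ h₀
    rw [Measure.map_apply hWpath (measurable_prodMk_left hBm)]
    obtain ⟨C, hJ⟩ := h₀.isHolderClock hD0 hD hσ (show 0 ≤ 2 * T by linarith)
    have hae : ∀ᵐ ω ∂P, ((fun n => τ n ω₀, fun t => W t ω) : (ℤ → ℝ) × (ℝ≥0 → ℝ)) ∉ B := by
      filter_upwards [ae_tendsto_realizedVar hWm hW hT hJ, hW.cont] with ω hω hc hmem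
      have hreg : IsRegularConfig τ' T (fun n => τ n ω₀, fun t => W t ω) :=
        ⟨h₀.strictMono, h₀.tendsto_atTop, h₀.neg, h₀.pos, h₀.ne⟩
      have heq : (fun u => W' u (fun n => τ n ω₀, fun t => W t ω)) = fun u => W u ω :=
        funext fun u => evalLimsup_of_continuous hc u
      have := eventually_notMem_farNearMax (W := W') hreg hD0 hD hσ hT hmem.1
        (by rw [heq]; exact hω) hε
      obtain ⟨N₀, hN₀⟩ := eventually_atTop.1 this
      obtain ⟨N, hN, hN2⟩ := hmem.2 N₀
      exact hN₀ N hN hN2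
    exact measure_eq_zero_iff_ae_notMem.2 hae
  have hprod : P.map (fun ω => ((fun n => τ n ω), fun t => W t ω)) B = 0 := by
    rw [(indepFun_iff_map_prod_eq_prod_map_map hτpath.aemeasurable hWpath.aemeasurable).1
      hWτ.symm, Measure.measure_prod_null hBm]
    exact (ae_map_iff hτpath.aemeasurable
      (measurable_measure_prodMk_left hBm (measurableSet_singleton 0))).2 hsec
  rw [Measure.map_apply (hτpath.prodMk hWpath) hBm] at hprod
  have hae : ∀ᵐ ω ∂P, ((fun n => τ n ω, fun t => W t ω) : (ℤ → ℝ) × (ℝ≥0 → ℝ)) ∉ B :=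
    measure_eq_zero_iff_ae_notMem.1 hprod
  filter_upwards [hae] with ω hω hE
  by_contra hcon
  refine hω ⟨hE, fun N₀ => ?_⟩
  by_contra hno
  exact hcon (eventually_atTop.2 ⟨N₀, fun N hN hmem => hno ⟨N, hN, hmem⟩⟩)

/-- The events where `μ N` is far from `m` may be nonmeasurable, but up to null sets they lie in
measurable events whose indicators tend to `0` almost surely. -/
lemma tendstoInMeasure_of_areMaxPoints (hD0 : 0 < D) (hD : D < 1 / 2) (hσ : 0 < σ) (hT : 0 < T)
    (hWm : ∀ t, Measurable (W t)) (hW : IsBrownianReal W P)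
    (hτ : IsPoissonPointProcess lam τ P)
    (hWτ : IndepFun (fun ω t => W t ω) (fun ω n => τ n ω) P) {μ : ℕ → Ω → ℝ}
    (hμ : AreMaxPoints P (recentShock D τ T) (discreteQuotient D σ W τ T) (searchLeft τ T)
        (searchRight D τ T) μ) :
    TendstoInMeasure (P.restrict (recentShock D τ T)) μ atTop (timeSinceShock τ T) := by
  rw [tendstoInMeasure_iff_dist]
  intro ε hε
  have hEm := measurableSet_recentShock hτ.measurable D T
  set A : ℕ → Set Ω := fun N =>
    farNearMax D σ (fun u ω => evalLimsup u (W · ω)) τ T ε N ∩ recentShock D τ T with hA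
  have hAm : ∀ N, MeasurableSet (A N) := fun N =>
    (measurableSet_farNearMax D σ T ε hτ.measurable (measurable_evalLimsup_path hWm) N).inter hEm
  have hlim : Tendsto (fun N => P (A N)) atTop (nhds 0) := by
    rw [← measure_empty (μ := P)]
    refine tendsto_measure_of_ae_tendsto_indicator atTop MeasurableSet.empty hAm
      MeasurableSet.univ (measure_ne_top _ _) (Eventually.of_forall fun _ => Set.subset_univ _) ?_
    filter_upwards [ae_eventually_notMem_farNearMax hD0 hD hσ hT hWm hW hτ hWτ hε] with ω hω
    by_cases hE : ω ∈ recentShock D τ T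
    · filter_upwards [hω hE] with N hN
      simp [hA, hN]
    · simp [hA, hE]
  refine tendsto_of_tendsto_of_tendsto_of_le_of_le' tendsto_const_nhds hlim
    (Eventually.of_forall fun _ => zero_le) ?_
  filter_upwards [eventually_ge_atTop 1] with N hN
  rw [Measure.restrict_apply' hEm]
  refine measure_mono_ae ?_
  filter_upwards [hμ N hN, hτ.ae_isRegularConfig T, hW.cont] with ω h1 hreg hc hω
  have hE : ω ∈ recentShock D τ T := hω.2
  have hW' : ∀ u, evalLimsup u (W · ω) = W u ω := evalLimsup_of_continuous hc
  obtain ⟨h2, h3⟩ := h1 hE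
  refine ⟨mem_farNearMax_of_isMaxOn hreg hD0 hD hσ hT hE ?_ hN hε h2 ?_ hω.1, hE⟩
  · simpa only [hW'] using hc
  · intro t ht
    have := h3 ht
    simp only [Set.mem_ofPred_eq] at this ⊢
    rwa [discreteQuotient_congr (W := fun u ω => evalLimsup u (W · ω)) (fun _ => rfl) hW',
      discreteQuotient_congr (W := fun u ω => evalLimsup u (W · ω)) (fun _ => rfl) hW']

end

end ShockModel

theorem theorem4p2 {Ω : Type*} [MeasurableSpace Ω] (P : Measure Ω) [IsProbabilityMeasure P]
    (D lam σ T : ℝ) (hD0 : 0 < D) (hD : D < 1 / 2) (hlam : 0 < lam) (hσ : 0 < σ) (hT : 0 < T)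
    (W : ℝ≥0 → Ω → ℝ) (hWm : ∀ t, Measurable (W t)) (hW : IsBrownianReal W P)
    (τ : ℤ → Ω → ℝ) (hτ : ShockModel.IsPoissonPointProcess lam τ P)
    (hWτ : IndepFun (fun ω t => W t ω) (fun ω n => τ n ω) P) :
    ∃ a b : Ω → ℝ,
      Measurable[MeasurableSpace.comap (fun ω n => τ n ω) MeasurableSpace.pi] a ∧
      Measurable[MeasurableSpace.comap (fun ω n => τ n ω) MeasurableSpace.pi] b ∧
      (∀ᵐ ω ∂P, ω ∈ ShockModel.recentShock D τ T →
        0 < a ω ∧ a ω < ShockModel.timeSinceShock τ T ω ∧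
          ShockModel.timeSinceShock τ T ω < b ω ∧ b ω ≤ T) ∧
      (∃ μ : ℕ → Ω → ℝ, (∀ N, Measurable (μ N)) ∧
        ShockModel.AreMaxPoints P (ShockModel.recentShock D τ T)
          (ShockModel.discreteQuotient D σ W τ T) a b μ) ∧
      ∀ μ : ℕ → Ω → ℝ,
        ShockModel.AreMaxPoints P (ShockModel.recentShock D τ T)
          (ShockModel.discreteQuotient D σ W τ T) a b μ →
        TendstoInMeasure (P.restrict (ShockModel.recentShock D τ T)) μ atTop
          (ShockModel.timeSinceShock τ T) := by
  -- The measurability lemmas hold for any σ-algebra making the shocks measurable, in particular for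
  -- the one they generate.
  have hcomap : ∀ n, Measurable[MeasurableSpace.comap (fun ω n => τ n ω) MeasurableSpace.pi]
      (τ n) := fun n => by
    have h : Measurable[MeasurableSpace.comap (fun ω n => τ n ω) MeasurableSpace.pi]
        fun ω n => τ n ω := comap_measurable _
    exact (measurable_pi_apply n).comp h
  refine ⟨ShockModel.searchLeft τ T, ShockModel.searchRight D τ T,
    ShockModel.measurable_searchLeft hcomap T, ShockModel.measurable_searchRight hcomap D T, ?_,
    ShockModel.exists_measurable_areMaxPoints hD0 hD hσ hT hWm hW hτ, fun μ hμ =>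
      ShockModel.tendstoInMeasure_of_areMaxPoints hD0 hD hσ hT hWm hW hτ hWτ hμ⟩
  filter_upwards [hτ.ae_isRegularConfig T] with ω h hE
  exact ⟨ShockModel.searchLeft_pos h hT, ShockModel.searchLeft_lt h hT,
    h.timeSinceShock_lt_searchRight hD0 hE, ShockModel.searchRight_le⟩
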